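/- All graphs are finite and simple. $P_m$ denotes the path on $m$ vertices, $v(G)$ and $e(G)$ the numbers of vertices and edges of $G$, $G[S]$ the subgraph induced by $S$, and $\chi$ the chromatic number. An edge control set of $G$ is a set $E'\subseteq E(G)$ such that every edge in $E(G)\setminus E'$ shares a vertex with some edge of $E'$; the edge control number $\beta_1(G)$ is the minimum size of an edge control set of $G$. For a family $\mathcal F$ of graphs, $ex(n,\mathcal F)$ is the maximum number of edges of an $n$-vertex graph that contains no member of $\mathcal F$ as a (not necessarily induced) subgraph, with $ex(n,\mathcal F)=-\infty$ if there is no such $n$-vertex graph. For a graph $F$ let $$\mathcal G_1(F)=\{F[V(F)\setminus S] : S\subseteq V(F),\ e(F[S])=0\},\qquad \mathcal G_2(F)=\{F[V(F)\setminus S] : S\subseteq V(F),\ e(F[S])\le 1\}.$$ **Theorem.** Let $H=H_1\cup\dots\cup H_k$ be the vertex-disjoint union of $k\ge 2$ paths, where $v(H_i)\ge 3$ for every $i$ and not all $H_i$ are $P_3$, and let $\ell=\sum_{i=1}^k\lfloor v(H_i)/2\rfloor$. Let $F$ be a graph with $\chi(F)\ge 3$ and $\beta_1(F)\ge 2$.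 Then there is $N$, depending only on $H$ and $F$, such that for all $n\ge N$: (i) if some $v(H_i)$ is even, then $$ex(n,\{H,F\})=(\ell-1)(n-\ell+1)+ex(\ell-1,\mathcal G_1(F));$$ (ii) if every $v(H_i)$ is odd, then $$ex(n,\{H,F\})=(\ell-1)(n-\ell+1)+\max\{ex(\ell-1,\mathcal G_1(F)),\ ex(\ell-1,\mathcal G_2(F))+1\}.$$ -/

import Mathlib

namespace TuranLF

/-- A family of graphs. Every finite graph is isomorphic to one whose vertex type lies in `Type`. -/
abbrev GraphFamily : Type 1 := Set (Σ V : Type, SimpleGraph V)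

/-- `G` is `𝓕`-free: no member of `𝓕` is a (not necessarily induced) subgraph of `G`,
up to isomorphism. -/
def FamilyFree (𝓕 : GraphFamily) {W : Type*} (G : SimpleGraph W) : Prop :=
  ∀ X ∈ 𝓕, X.2.Free G

open Classical in
/-- The Turán number `ex(n, 𝓕)`: the maximum number of edges of an `𝓕`-free graph on `n` vertices.
The maximum of the empty set is `⊥` (that is, `-∞`); `ex(n, 𝓕) = ⊥` exactly if every `n`-vertex
graph contains a member of `𝓕`. -/
noncomputable def ex (n : ℕ) (𝓕 : GraphFamily) : WithBot ℕ :=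
  (Finset.univ.filter fun G : SimpleGraph (Fin n) => FamilyFree 𝓕 G).sup
    fun G => ((G.edgeFinset.card : ℕ) : WithBot ℕ)

/-- `E'` is an edge control set of `G`: a set of edges such that every other edge of `G` shares a
vertex with an edge in `E'`. -/
def IsEdgeControlSet {V : Type*} (G : SimpleGraph V) (E' : Set (Sym2 V)) : Prop :=
  E' ⊆ G.edgeSet ∧ ∀ e ∈ G.edgeSet \ E', ∃ e' ∈ E', ∃ v : V, v ∈ e ∧ v ∈ e'

/-- The edge control number `β₁(G)`: the minimum size of an edge control set of `G`. -/
noncomputable def edgeControlNumber {V : Type*} (G : SimpleGraph V) : ℕ∞ :=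
  ⨅ (E' : Set (Sym2 V)) (_ : IsEdgeControlSet G E'), E'.encard

/-- The family of all `F[V(F) \ S]`, where `S ⊆ V(F)` and `F[S]` has no edge. -/
def G₁ {V : Type} (F : SimpleGraph V) : GraphFamily :=
  {X | ∃ S : Set V, (F.induce S).edgeSet.encard = 0 ∧ X = ⟨(Sᶜ : Set V), F.induce Sᶜ⟩}

/-- The family of all `F[V(F) \ S]`, where `S ⊆ V(F)` and `F[S]` has at most one edge. -/
def G₂ {V : Type} (F : SimpleGraph V) : GraphFamily :=
  {X | ∃ S : Set V, (F.induce S).edgeSet.encard ≤ 1 ∧ X = ⟨(Sᶜ : Set V), F.induce Sᶜ⟩}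

/-- The linear forest `P_{p 0} ∪ ⋯ ∪ P_{p (k-1)}`: the vertex-disjoint union of paths, the `i`-th
of which has `p i` vertices. -/
def linearForest {k : ℕ} (p : Fin k → ℕ) : SimpleGraph (Σ i : Fin k, Fin (p i)) :=
  ⨆ i : Fin k, (SimpleGraph.pathGraph (p i)).map (Function.Embedding.sigmaMk i)

end TuranLF

namespace TuranLF

open scoped Classical

/-- A list of vertices that traverses a path of `G`. -/
def IsPathList {V : Type*} (G : SimpleGraph V) (l : List V) : Prop := l.IsChain G.Adj ∧ l.Nodup

section LinearForest

variable {V : Type*} {k : ℕ} {p : Fin k → ℕ}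

theorem linearForest_adj {x y : Σ i : Fin k, Fin (p i)} :
    (linearForest p).Adj x y ↔ ∃ (i : Fin k) (a b : Fin (p i)),
      ((a : ℕ) + 1 = b ∨ (b : ℕ) + 1 = a) ∧ x = ⟨i, a⟩ ∧ y = ⟨i, b⟩ := by
  simp only [linearForest, SimpleGraph.iSup_adj, SimpleGraph.map_adj, SimpleGraph.pathGraph_adj,
    Function.Embedding.sigmaMk_apply]
  constructor
  · rintro ⟨i, a, b, h, rfl, rfl⟩
    exact ⟨i, a, b, h, rfl, rfl⟩
  · rintro ⟨i, a, b, h, rfl, rfl⟩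
    exact ⟨i, a, b, h, rfl, rfl⟩

theorem linearForest_isContained_of_map {G : SimpleGraph V} (f : (Σ i : Fin k, Fin (p i)) → V)
    (hf : Function.Injective f)
    (h : ∀ (i : Fin k) (a b : Fin (p i)), (a : ℕ) + 1 = b → G.Adj (f ⟨i, a⟩) (f ⟨i, b⟩)) :
    (linearForest p).IsContained G := by
  refine ⟨⟨⟨f, ?_⟩, hf⟩⟩
  intro x y hxy
  obtain ⟨i, a, b, hab | hab, rfl, rfl⟩ := linearForest_adj.1 hxy
  · exact h i a b hab
  · exact (h i b a hab).symm

theorem linearForest_isContained_of_lists {G : SimpleGraph V} (L : Fin k → List V)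
    (hL : ∀ i, IsPathList G (L i)) (hlen : ∀ i, p i ≤ (L i).length)
    (hd : ∀ i j, i ≠ j → ∀ x ∈ L i, x ∉ L j) : (linearForest p).IsContained G := by
  refine linearForest_isContained_of_map
    (fun x => (L x.1)[(x.2 : ℕ)]'(lt_of_lt_of_le x.2.2 (hlen x.1))) ?_ ?_
  · rintro ⟨i, a⟩ ⟨j, b⟩ h
    by_cases hij : i = j
    · subst hij
      have := (List.Nodup.getElem_inj_iff (hL i).2).1 h
      obtain rfl : a = b := Fin.ext this
      rfl
    · exact absurd (by simp only at h; rw [h]; exact List.getElem_mem _) (hd i j hij _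
        (List.getElem_mem (lt_of_lt_of_le a.2 (hlen i))))
  · intro i a b hab
    have := List.isChain_iff_getElem.1 (hL i).1 a (by have := hlen i; omega)
    simpa only [hab] using this

theorem linearForest_isContained_of_long_list {G : SimpleGraph V} (l : List V)
    (hl : IsPathList G l) (hlen : ∑ i, p i ≤ l.length) : (linearForest p).IsContained G := by
  refine linearForest_isContained_of_map
    (fun x => l[(finSigmaFinEquiv x : ℕ)]'(lt_of_lt_of_le (finSigmaFinEquiv x).2 hlen)) ?_ ?_
  · intro x y h
    exact finSigmaFinEquiv.injective (Fin.ext ((List.Nodup.getElem_inj_iff hl.2).1 h))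
  · intro i a b hab
    have h1 : (finSigmaFinEquiv ⟨i, b⟩ : ℕ) = (finSigmaFinEquiv ⟨i, a⟩ : ℕ) + 1 := by
      rw [finSigmaFinEquiv_apply, finSigmaFinEquiv_apply]
      simp only
      omega
    have := List.isChain_iff_getElem.1 hl.1 (finSigmaFinEquiv ⟨i, a⟩ : ℕ)
      (by rw [← h1]; exact lt_of_lt_of_le (finSigmaFinEquiv _).2 hlen)
    simpa only [h1] using this

/-- Fewer than `∑ i, p i / 2` vertices miss an edge of each maximum matching of a copy of the linear
forest that consists of the edges `{2 j + o, 2 j + o + 1}` of the paths. -/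
theorem exists_matching_edge {G : SimpleGraph V} (f : (linearForest p).Copy G) (o : ℕ)
    (ho : ∀ i, 2 * (p i / 2) + o ≤ p i) (U : Finset V) (hU : U.card < ∑ i, p i / 2) :
    ∃ (i : Fin k) (a b : Fin (p i)), (∃ j : ℕ, (a : ℕ) = 2 * j + o) ∧ (b : ℕ) = a + 1 ∧
      f ⟨i, a⟩ ∉ U ∧ f ⟨i, b⟩ ∉ U := by
  by_contra! hcon
  have key : ∀ x : Σ i : Fin k, Fin (p i / 2), ∃ c : Fin (p x.1),
      f ⟨x.1, c⟩ ∈ U ∧ ((c : ℕ) = 2 * x.2 + o ∨ (c : ℕ) = 2 * x.2 + o + 1) := by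
    rintro ⟨i, j⟩
    have h1 := ho i
    have h2 := j.2
    have := hcon i ⟨2 * j + o, by omega⟩ ⟨2 * j + o + 1, by omega⟩
      ⟨j, rfl⟩ rfl
    by_cases h : f ⟨i, ⟨2 * j + o, by omega⟩⟩ ∈ U
    · exact ⟨_, h, Or.inl rfl⟩
    · exact ⟨_, this h, Or.inr rfl⟩
  choose c hcU hc using key
  have hcard := Finset.card_le_card_of_injOn (s := Finset.univ) (t := U)
    (fun x : Σ i : Fin k, Fin (p i / 2) => f ⟨x.1, c x⟩) (fun x _ => hcU x) (by
      rintro x - y - hxy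
      have h1 := f.injective hxy
      obtain ⟨i, a⟩ := x
      obtain ⟨j, b⟩ := y
      obtain rfl : i = j := (Sigma.mk.inj_iff.1 h1).1
      have h2 : c ⟨i, a⟩ = c ⟨i, b⟩ := by simpa using h1
      have h3 := hc ⟨i, a⟩
      have h4 := hc ⟨i, b⟩
      rw [h2] at h3
      have : a = b := Fin.ext (by simp only at h3 h4; omega)
      rw [this])
  simp at hcard
  omega

end LinearForest

section Degrees

variable {V : Type*}

/-- The number of neighbours of `x` in `S`. -/
noncomputable def degIn (G : SimpleGraph V) (S : Finset V) (x : V) : ℕ :=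
  (S.filter (G.Adj x)).card

/-- Twice the number of edges inside `S`. -/
noncomputable def degSum (G : SimpleGraph V) (S : Finset V) : ℕ := ∑ x ∈ S, degIn G S x

theorem degIn_union (G : SimpleGraph V) {S T : Finset V} (h : Disjoint S T) (x : V) :
    degIn G (S ∪ T) x = degIn G S x + degIn G T x := by
  rw [degIn, Finset.filter_union, Finset.card_union_of_disjoint]; rfl
  exact Finset.disjoint_filter_filter h

theorem degIn_singleton_self (G : SimpleGraph V) (x : V) : degIn G {x} x = 0 := by
  simp [degIn, Finset.filter_singleton]

theorem degIn_erase_self (G : SimpleGraph V) (S : Finset V) (x : V) :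
    degIn G (S.erase x) x = degIn G S x := by
  unfold degIn
  congr 1
  ext y
  simp only [Finset.mem_filter, Finset.mem_erase]
  constructor
  · rintro ⟨⟨_, h⟩, h'⟩; exact ⟨h, h'⟩
  · rintro ⟨h, h'⟩; exact ⟨⟨h'.ne', h⟩, h'⟩

theorem sum_degIn_comm (G : SimpleGraph V) (S T : Finset V) :
    ∑ x ∈ S, degIn G T x = ∑ y ∈ T, degIn G S y := by
  simp only [degIn, Finset.card_filter]
  rw [Finset.sum_comm]
  simp only [G.adj_comm]

theorem degSum_union (G : SimpleGraph V) {S T : Finset V} (h : Disjoint S T) :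
    degSum G (S ∪ T) = degSum G S + degSum G T + 2 * ∑ x ∈ T, degIn G S x := by
  unfold degSum
  rw [Finset.sum_union h]
  simp only [degIn_union G h, Finset.sum_add_distrib]
  rw [sum_degIn_comm G S T]
  ring

theorem degSum_singleton (G : SimpleGraph V) (x : V) : degSum G {x} = 0 := by
  simp [degSum, degIn_singleton_self]

theorem degSum_insert (G : SimpleGraph V) {S : Finset V} {x : V} (h : x ∉ S) :
    degSum G (insert x S) = degSum G S + 2 * degIn G S x := by
  rw [Finset.insert_eq, Finset.union_comm,
    degSum_union G (by simpa using h), degSum_singleton]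
  simp

theorem degSum_univ (G : SimpleGraph V) [Fintype V] [Fintype G.edgeSet] :
    degSum G Finset.univ = 2 * G.edgeFinset.card := by
  have := G.sum_degrees_eq_twice_card_edges
  trans ∑ v, G.degree v
  swap
  · convert this
  refine Finset.sum_congr rfl fun x _ => ?_
  rw [degIn, ← SimpleGraph.card_neighborFinset_eq_degree, SimpleGraph.neighborFinset_eq_filter]

theorem degSum_induce (G : SimpleGraph V) (U : Finset V)
    [Fintype (G.induce (U : Set V)).edgeSet] :
    degSum G U = 2 * (G.induce (U : Set V)).edgeFinset.card := by
  rw [← degSum_univ]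
  unfold degSum
  rw [← Finset.sum_coe_sort]
  refine Finset.sum_congr rfl fun x _ => ?_
  unfold degIn
  refine (Finset.card_bij (fun (y : (U : Set V)) _ => (y : V)) ?_ ?_ ?_).symm
  · rintro ⟨y, hy⟩ h
    rw [Finset.mem_filter] at h ⊢
    exact ⟨hy, h.2⟩
  · rintro ⟨y, hy⟩ _ ⟨z, hz⟩ _ h
    exact Subtype.ext h
  · intro y hy
    rw [Finset.mem_filter] at hy
    exact ⟨⟨y, hy.1⟩, by simpa using hy.2, rfl⟩

theorem degIn_lt_card (G : SimpleGraph V) {S : Finset V} {x : V} (hx : x ∈ S) :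
    degIn G S x ≤ S.card - 1 := by
  rw [← degIn_erase_self, ← Finset.card_erase_of_mem hx]
  exact Finset.card_filter_le _ _

theorem degSum_le (G : SimpleGraph V) (S : Finset V) : degSum G S ≤ S.card * (S.card - 1) := by
  unfold degSum
  calc _ ≤ ∑ x ∈ S, (S.card - 1) := Finset.sum_le_sum fun x hx => degIn_lt_card G hx
    _ = _ := by simp

end Degrees

section Paths

variable {V : Type*}

theorem IsPathList.reverse {G : SimpleGraph V} {l : List V} (h : IsPathList G l) :
    IsPathList G l.reverse :=
  ⟨by rw [List.isChain_reverse]; exact h.1.imp fun _ _ h => h.symm, List.nodup_reverse.2 h.2⟩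

theorem IsPathList.mono {G G' : SimpleGraph V} (hG : G ≤ G') {l : List V} (h : IsPathList G l) :
    IsPathList G' l :=
  ⟨h.1.imp fun _ _ h => hG h, h.2⟩

theorem IsPathList.cons {G : SimpleGraph V} {x : V} {l : List V} (h : IsPathList G l)
    (hx : x ∉ l) (hadj : ∀ z ∈ l.head?, G.Adj x z) : IsPathList G (x :: l) :=
  ⟨List.isChain_cons.2 ⟨hadj, h.1⟩, List.nodup_cons.2 ⟨hx, h.2⟩⟩

theorem IsPathList.append {G : SimpleGraph V} {l l' : List V} (h : IsPathList G l)
    (h' : IsPathList G l') (hd : ∀ x ∈ l, x ∉ l')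
    (hadj : ∀ x ∈ l.getLast?, ∀ y ∈ l'.head?, G.Adj x y) : IsPathList G (l ++ l') :=
  ⟨List.isChain_append.2 ⟨h.1, h'.1, hadj⟩,
    List.nodup_append.2 ⟨h.2, h'.2, fun x hx _ hy hxy => hd x hx (hxy ▸ hy)⟩⟩

theorem IsPathList.take {G : SimpleGraph V} {l : List V} (h : IsPathList G l) (m : ℕ) :
    IsPathList G (l.take m) :=
  ⟨h.1.take m, h.2.sublist (List.take_sublist m l)⟩

theorem isPathList_singleton (G : SimpleGraph V) (x : V) : IsPathList G [x] :=
  ⟨List.IsChain.singleton x, List.nodup_singleton x⟩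

/-- `T` cannot be split into two nonempty parts without edges of `G` between them. -/
def CutConn (G : SimpleGraph V) (T : Finset V) : Prop :=
  ∀ X ⊆ T, X.Nonempty → (∀ x ∈ X, ∀ y ∈ T, G.Adj x y → y ∈ X) → X = T

/-- `C` is the vertex set of a connected component of `G[R]`. -/
structure IsComp (G : SimpleGraph V) (R C : Finset V) : Prop where
  nonempty : C.Nonempty
  subset : C ⊆ R
  conn : CutConn G C
  closed : ∀ x ∈ C, ∀ y ∈ R, G.Adj x y → y ∈ C

theorem IsComp.eq_of_mem {G : SimpleGraph V} {R C C' : Finset V} (h : IsComp G R C)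
    (h' : IsComp G R C') {x : V} (hx : x ∈ C) (hx' : x ∈ C') : C = C' := by
  have hne : (C ∩ C').Nonempty := ⟨x, Finset.mem_inter.2 ⟨hx, hx'⟩⟩
  have h1 : C ∩ C' = C := h.conn _ Finset.inter_subset_left hne fun y hy z hz hyz =>
    Finset.mem_inter.2 ⟨hz, h'.closed y (Finset.mem_inter.1 hy).2 z (h.subset hz) hyz⟩
  have h2 : C ∩ C' = C' := h'.conn _ Finset.inter_subset_right hne fun y hy z hz hyz =>
    Finset.mem_inter.2 ⟨h.closed y (Finset.mem_inter.1 hy).1 z (h'.subset hz) hyz, hz⟩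
  exact h1.symm.trans h2

theorem exists_isComp (G : SimpleGraph V) {R : Finset V} {x : V} (hx : x ∈ R) :
    ∃ C, IsComp G R C ∧ x ∈ C := by
  set C := R.filter fun y => ∀ X ⊆ R, (∀ a ∈ X, ∀ b ∈ R, G.Adj a b → b ∈ X) → x ∈ X → y ∈ X
    with hC
  have hxC : x ∈ C := Finset.mem_filter.2 ⟨hx, fun X _ _ h => h⟩
  have hCR : C ⊆ R := Finset.filter_subset _ _
  have hcl : ∀ a ∈ C, ∀ b ∈ R, G.Adj a b → b ∈ C := fun a ha b hb hab =>
    Finset.mem_filter.2 ⟨hb, fun X hX hXc hxX =>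
      hXc a ((Finset.mem_filter.1 ha).2 X hX hXc hxX) b hb hab⟩
  refine ⟨C, ⟨⟨x, hxC⟩, hCR, ?_, hcl⟩, hxC⟩
  intro X hX hne hXc
  refine Finset.Subset.antisymm hX ?_
  by_cases hxX : x ∈ X
  · intro y hy
    exact (Finset.mem_filter.1 hy).2 X (hX.trans hCR)
      (fun a ha b hb hab => hXc a ha b (hcl a (hX ha) b hb hab) hab) hxX
  · obtain ⟨y, hy⟩ := hne
    have := (Finset.mem_filter.1 (hX hy)).2 (C \ X) (Finset.sdiff_subset.trans hCR)
      (fun a ha b hb hab => by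
        rw [Finset.mem_sdiff] at ha ⊢
        exact ⟨hcl a ha.1 b hb hab, fun hbX => ha.2 (hXc b hbX a ha.1 hab.symm)⟩)
      (Finset.mem_sdiff.2 ⟨hxC, hxX⟩)
    exact absurd hy (Finset.mem_sdiff.1 this).2

theorem CutConn.exists_path {G : SimpleGraph V} {T : Finset V} (hT : CutConn G T) {x y : V}
    (hx : x ∈ T) (hy : y ∈ T) :
    ∃ l, IsPathList G l ∧ (∀ z ∈ l, z ∈ T) ∧ l.head? = some x ∧ l.getLast? = some y := by
  let H : SimpleGraph V :=
    { Adj := fun a b => G.Adj a b ∧ a ∈ T ∧ b ∈ T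
      symm := ⟨fun a b h => ⟨h.1.symm, h.2.2, h.2.1⟩⟩
      loopless := ⟨fun a h => G.loopless.irrefl a h.1⟩ }
  have hX : T.filter (fun z => H.Reachable x z) = T := by
    refine hT _ (Finset.filter_subset _ _) ⟨x, Finset.mem_filter.2 ⟨hx, .refl x⟩⟩ ?_
    intro a ha b hb hab
    rw [Finset.mem_filter] at ha ⊢
    exact ⟨hb, ha.2.trans (SimpleGraph.Adj.reachable (G := H) ⟨hab, ha.1, hb⟩)⟩
  rw [← hX] at hy
  obtain ⟨w, hw⟩ := (Finset.mem_filter.1 hy).2.exists_isPath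
  have hsupp : ∀ {a b : V} (q : H.Walk a b), a ∈ T → ∀ z ∈ q.support, z ∈ T := by
    intro a b q
    induction q with
    | nil => intro ha z hz; simp at hz; exact hz ▸ ha
    | cons h q ih =>
      intro ha z hz
      rw [SimpleGraph.Walk.support_cons, List.mem_cons] at hz
      rcases hz with rfl | hz
      · exact ha
      · exact ih h.2.2 z hz
  refine ⟨w.support, ⟨w.isChain_adj_support.imp fun _ _ h => h.1, hw.support_nodup⟩,
    hsupp w hx, ?_, ?_⟩
  · rw [List.head?_eq_some_head w.support_ne_nil, SimpleGraph.Walk.head_support]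
  · rw [List.getLast?_eq_some_getLast w.support_ne_nil, SimpleGraph.Walk.getLast_support]

theorem exists_path_of_minDegree {G : SimpleGraph V} {T : Finset V} {δ : ℕ}
    (hδ : ∀ x ∈ T, δ ≤ degIn G T x) {w : V} (hw : w ∈ T) :
    ∃ l, IsPathList G l ∧ (∀ z ∈ l, z ∈ T) ∧ l.head? = some w ∧ δ + 1 ≤ l.length := by
  have key : ∀ j ≤ δ, ∃ l, IsPathList G l ∧ (∀ z ∈ l, z ∈ T) ∧ l.getLast? = some w ∧
      l.length = j + 1 := by
    intro j
    induction j with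
    | zero => exact fun _ => ⟨[w], isPathList_singleton G w, by simpa using hw, rfl, rfl⟩
    | succ j ih =>
      intro hj
      obtain ⟨l, hl, hlT, hlast, hlen⟩ := ih (by omega)
      match l, hlen with
      | x :: t, hlen =>
        have hxT : x ∈ T := hlT x (by simp)
        obtain ⟨y, hy, hyt⟩ := Finset.exists_mem_notMem_of_card_lt_card
          (s := t.toFinset) (t := T.filter (G.Adj x)) (by
            have h1 := hδ x hxT
            have h2 := List.toFinset_card_le t
            simp only [List.length_cons] at hlen
            unfold degIn at h1
            omega)
        rw [Finset.mem_filter] at hy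
        refine ⟨y :: x :: t, hl.cons ?_ ?_, ?_, ?_, ?_⟩
        · rw [List.mem_cons, not_or]
          exact ⟨hy.2.ne', by simpa using hyt⟩
        · intro z hz
          simp only [List.head?_cons, Option.mem_def, Option.some.injEq] at hz
          exact hz ▸ hy.2.symm
        · intro z hz
          rcases List.mem_cons.1 hz with rfl | hz
          · exact hy.1
          · exact hlT z hz
        · rw [List.getLast?_cons_cons]; exact hlast
        · simp only [List.length_cons] at hlen ⊢; omega
  obtain ⟨l, hl, hlT, hlast, hlen⟩ := key δ le_rfl
  exact ⟨l.reverse, hl.reverse, by simpa using hlT, by simpa using hlast, by simp [hlen]⟩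

/-- A path in a connected graph of minimum degree `δ` whose number of vertices is at most `2δ` and
less than the number of vertices of the graph is not a longest one. -/
theorem CutConn.exists_longer_path {G : SimpleGraph V} {T : Finset V} (hT : CutConn G T) {δ : ℕ}
    (hδ : ∀ x ∈ T, δ ≤ degIn G T x) {l : List V} (hl : IsPathList G l) (hlT : ∀ z ∈ l, z ∈ T)
    (hne : l ≠ []) (hlen : l.length ≤ 2 * δ) (hcard : l.length < T.card) :
    ∃ l', IsPathList G l' ∧ (∀ z ∈ l', z ∈ T) ∧ l'.length = l.length + 1 := by
  have hcons : ∀ l : List V, IsPathList G l → (∀ z ∈ l, z ∈ T) → ∀ x ∈ l.head?, ∀ y ∈ T, y ∉ l →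
      G.Adj x y → ∃ l', IsPathList G l' ∧ (∀ z ∈ l', z ∈ T) ∧ l'.length = l.length + 1 := by
    intro l hl hlT x hx y hyT hyl hxy
    refine ⟨y :: l, hl.cons hyl ?_, ?_, by simp⟩
    · intro z hz
      obtain rfl : x = z := Option.mem_unique hx hz
      exact hxy.symm
    · intro z hz
      rcases List.mem_cons.1 hz with rfl | hz
      exacts [hyT, hlT z hz]
  by_contra hcon
  have hpos : 0 < l.length := List.length_pos_of_ne_nil hne
  have hfirst : ∀ y ∈ T, G.Adj l[0] y → y ∈ l := by
    intro y hy hadj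
    by_contra hyl
    exact hcon (hcons l hl hlT l[0] (by simp [List.head?_eq_getElem?]) y hy hyl hadj)
  have hlast : ∀ y ∈ T, G.Adj l[l.length - 1] y → y ∈ l := by
    intro y hy hadj
    by_contra hyl
    obtain ⟨l', h1, h2, h3⟩ := hcons l.reverse hl.reverse (by simpa using hlT) l[l.length - 1]
      (by rw [List.head?_reverse, List.getLast?_eq_getElem?]; simp) y hy (by simpa using hyl) hadj
    exact hcon ⟨l', h1, h2, by simpa using h3⟩
  set t := l.length with ht
  -- the positions before a neighbour of the first vertex and those of the neighbours of the last
  let I := (Finset.range (t - 1)).filter fun i => ∃ h : i + 1 < l.length, G.Adj l[0] l[i + 1]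
  let J := (Finset.range (t - 1)).filter fun i => ∃ h : i < l.length, G.Adj l[t - 1] l[i]
  have hI : δ ≤ I.card := by
    refine (hδ l[0] (hlT _ (List.getElem_mem _))).trans ?_
    refine Finset.card_le_card_of_surjOn (fun i => if h : i + 1 < l.length then l[i + 1] else l[0]) ?_
    intro y hy
    have hy' := Finset.mem_filter.1 (Finset.mem_coe.1 hy)
    obtain ⟨i, hi, rfl⟩ := List.mem_iff_getElem.1 (hfirst y hy'.1 hy'.2)
    have hi0 : i ≠ 0 := by rintro rfl; exact hy'.2.ne rfl
    obtain ⟨i, rfl⟩ := Nat.exists_eq_succ_of_ne_zero hi0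
    refine ⟨i, Finset.mem_coe.2 (Finset.mem_filter.2 ⟨Finset.mem_range.2 (by omega), hi, hy'.2⟩), ?_⟩
    simp only [Nat.succ_eq_add_one] at hi
    simp [hi]
  have hJ : δ ≤ J.card := by
    refine (hδ l[t - 1] (hlT _ (List.getElem_mem _))).trans ?_
    refine Finset.card_le_card_of_surjOn (fun i => if h : i < l.length then l[i] else l[0]) ?_
    intro y hy
    have hy' := Finset.mem_filter.1 (Finset.mem_coe.1 hy)
    obtain ⟨i, hi, rfl⟩ := List.mem_iff_getElem.1 (hlast y hy'.1 hy'.2)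
    have hi0 : i ≠ t - 1 := by rintro rfl; exact hy'.2.ne rfl
    refine ⟨i, Finset.mem_coe.2 (Finset.mem_filter.2 ⟨Finset.mem_range.2 (by omega), hi, hy'.2⟩), ?_⟩
    simp [hi]
  obtain ⟨i, hi⟩ : (I ∩ J).Nonempty := by
    rw [← Finset.card_pos]
    have h1 := Finset.card_union_add_card_inter I J
    have h2 : (I ∪ J).card ≤ t - 1 := by
      rw [← Finset.card_range (t - 1)]
      exact Finset.card_le_card (Finset.union_subset (Finset.filter_subset _ _)
        (Finset.filter_subset _ _))
    omega
  obtain ⟨hi1, hi2⟩ := Finset.mem_inter.1 hi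
  obtain ⟨hir, hi', hiI⟩ := Finset.mem_filter.1 hi1
  obtain ⟨-, hi'', hiJ⟩ := Finset.mem_filter.1 hi2
  have hir := Finset.mem_range.1 hir
  -- the closed traversal
  obtain ⟨c, hc, hcl, hcyc⟩ : ∃ c : List V, IsPathList G c ∧ c.Perm l ∧
      ∀ x ∈ c.getLast?, ∀ y ∈ c.head?, G.Adj x y := by
    refine ⟨l.take (i + 1) ++ (l.drop (i + 1)).reverse, ?_, ?_, ?_⟩
    · have hsp : IsPathList G (l.take (i + 1) ++ l.drop (i + 1)) := by
        rw [List.take_append_drop]; exact hl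
      have h1 := List.isChain_append.1 hsp.1
      have h2 := List.nodup_append.1 hsp.2
      refine (hl.take _).append (IsPathList.reverse ⟨h1.2.1, h2.2.1⟩) ?_ ?_
      · intro x hx hx'
        exact h2.2.2 x hx x (List.mem_reverse.1 hx') rfl
      · intro x hx y hy
        rw [List.getLast?_take] at hx
        rw [List.head?_reverse, List.getLast?_drop] at hy
        have e1 : l.getLast? = some l[t - 1] := by
          rw [List.getLast?_eq_getElem?]; exact List.getElem?_eq_getElem _
        rw [if_neg (by omega), e1] at hy
        have e2 : l[i]? = some l[i] := by simp
        simp only [Nat.add_eq_zero_iff, one_ne_zero, and_false, if_false, Nat.add_sub_cancel,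
          e2, Option.some_or, Option.mem_def, Option.some.injEq] at hx hy
        rw [← hx, ← hy]
        exact hiJ.symm
    · exact ((List.reverse_perm _).append_left _).trans (by rw [List.take_append_drop])
    · intro x hx y hy
      have e3 : (l.drop (i + 1)).head? = some l[i + 1] := by
        rw [List.head?_drop]; simp [hi']
      rw [List.getLast?_append, List.getLast?_reverse, e3] at hx
      rw [List.head?_append, List.head?_take, if_neg (by omega), List.head?_eq_getElem?] at hy
      have e4 : l[0]? = some l[0] := by simp
      simp only [e4, Option.some_or, Option.mem_def, Option.some.injEq] at hx hy
      rw [← hx, ← hy]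
      exact hiI.symm
  obtain ⟨x, hx, y, hyT, hyl, hxy⟩ : ∃ x ∈ l, ∃ y ∈ T, y ∉ l ∧ G.Adj x y := by
    by_contra! hno
    have := hT l.toFinset (fun z hz => hlT z (List.mem_toFinset.1 hz))
      ⟨l[0], List.mem_toFinset.2 (List.getElem_mem _)⟩ (fun x hx y hy hxy => by
        by_contra hyl
        exact hno x (List.mem_toFinset.1 hx) y hy (fun h => hyl (List.mem_toFinset.2 h)) hxy)
    rw [← this] at hcard
    exact absurd (List.toFinset_card_le l) (by omega)
  obtain ⟨a, b, rfl⟩ := List.append_of_mem (hcl.mem_iff.2 hx)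
  have h1 := List.isChain_append.1 hc.1
  have h2 := List.nodup_append.1 hc.2
  have hrot : IsPathList G (x :: b ++ a) := by
    refine IsPathList.append ⟨h1.2.1, h2.2.1⟩ ⟨h1.1, h2.1⟩ ?_ ?_
    · intro u hu hu'
      exact h2.2.2 u hu' u hu rfl
    · intro u hu v hv
      refine hcyc u ?_ v ?_
      · rw [List.getLast?_append]
        rw [Option.mem_def] at hu
        simp [hu]
      · rw [List.head?_append]
        rw [Option.mem_def] at hv
        simp [hv]
  have hperm : (x :: b ++ a).Perm l := List.perm_append_comm.trans hcl
  obtain ⟨l', q1, q2, q3⟩ := hcons _ hrot (fun z hz => hlT z (hperm.mem_iff.1 hz)) x (by simp) y hyT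
    (fun h => hyl (hperm.mem_iff.1 h)) hxy
  exact hcon ⟨l', q1, q2, by rw [q3, hperm.length_eq]⟩

theorem CutConn.exists_long_path {G : SimpleGraph V} {T : Finset V} (hT : CutConn G T) {δ : ℕ}
    (hδ : ∀ x ∈ T, δ ≤ degIn G T x) (hcard : 2 * δ + 1 ≤ T.card) :
    ∃ l, IsPathList G l ∧ (∀ z ∈ l, z ∈ T) ∧ l.length = 2 * δ + 1 := by
  have key : ∀ j ≤ 2 * δ, ∃ l, IsPathList G l ∧ (∀ z ∈ l, z ∈ T) ∧ l.length = j + 1 := by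
    intro j
    induction j with
    | zero =>
      intro _
      obtain ⟨x, hx⟩ := Finset.card_pos.1 (show 0 < T.card by omega)
      exact ⟨[x], isPathList_singleton G x, by simpa using hx, rfl⟩
    | succ j ih =>
      intro hj
      obtain ⟨l, hl, hlT, hlen⟩ := ih (by omega)
      obtain ⟨l', h1, h2, h3⟩ := hT.exists_longer_path hδ hl hlT (by rintro rfl; simp at hlen)
        (by omega) (by omega)
      exact ⟨l', h1, h2, by omega⟩
  exact key _ le_rfl

end Paths

section Packing

theorem exists_disjoint_subsets {κ α : Type*} [Fintype κ] (S : Finset α) (c : κ → ℕ)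
    (h : ∑ i, c i ≤ S.card) : ∃ A : κ → Finset α, (∀ i, A i ⊆ S) ∧ (∀ i, (A i).card = c i) ∧
      ∀ i j, i ≠ j → Disjoint (A i) (A j) := by
  obtain ⟨f⟩ : Nonempty ((Σ i, Fin (c i)) ↪ S) :=
    Function.Embedding.nonempty_of_card_le (by simpa using h)
  refine ⟨fun i => Finset.univ.image fun a : Fin (c i) => (f ⟨i, a⟩ : α), ?_, ?_, ?_⟩
  · intro i x hx
    obtain ⟨a, -, rfl⟩ := Finset.mem_image.1 hx
    exact (f ⟨i, a⟩).2
  · intro i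
    rw [Finset.card_image_of_injective, Finset.card_univ, Fintype.card_fin]
    intro a b hab
    simpa using f.injective (Subtype.ext hab)
  · intro i j hij
    rw [Finset.disjoint_left]
    intro x hx hx'
    obtain ⟨a, -, rfl⟩ := Finset.mem_image.1 hx
    obtain ⟨b, -, hb⟩ := Finset.mem_image.1 hx'
    have := f.injective (Subtype.ext hb)
    exact hij (Sigma.mk.inj_iff.1 this).1.symm

variable {V : Type*}

/-- There is a path with at least `m` vertices inside `E` that starts at a neighbour of `u`. -/
def HasTail (G : SimpleGraph V) (u : V) (E : Finset V) (m : ℕ) : Prop :=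
  ∃ l, IsPathList G l ∧ (∀ x ∈ l, x ∈ E) ∧ m ≤ l.length ∧ ∃ x, l.head? = some x ∧ G.Adj u x

/-- Pairwise disjoint sets `T j`, `j ∈ K`, each of which links any two vertices of `U`. -/
structure Links (G : SimpleGraph V) (U : Finset V) {ι : Type*} (T : ι → Finset V)
    (K : Finset ι) : Prop where
  disjU : ∀ j ∈ K, Disjoint (T j) U
  disj : ∀ i ∈ K, ∀ j ∈ K, i ≠ j → Disjoint (T i) (T j)
  link : ∀ j ∈ K, ∀ u ∈ U, ∀ u' ∈ U, ∃ l, IsPathList G l ∧ (∀ x ∈ l, x ∈ T j) ∧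
    (∃ x, l.head? = some x ∧ G.Adj u x) ∧ ∃ y, l.getLast? = some y ∧ G.Adj u' y

variable {G : SimpleGraph V} {U : Finset V} {ι : Type*} {T : ι → Finset V}

theorem Links.mono {K K' : Finset ι} (h : Links G U T K) (hK : K' ⊆ K) : Links G U T K' :=
  ⟨fun j hj => h.disjU j (hK hj), fun i hi j hj => h.disj i (hK hi) j (hK hj),
    fun j hj => h.link j (hK hj)⟩

theorem Links.anti {K : Finset ι} {U' : Finset V} (h : Links G U T K) (hU : U' ⊆ U) :
    Links G U' T K :=
  ⟨fun j hj => (h.disjU j hj).mono_right hU, h.disj,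
    fun j hj u hu u' hu' => h.link j hj u (hU hu) u' (hU hu')⟩

theorem Links.exists_path_from {E : Finset V} {m : ℕ} (hEU : Disjoint E U) (c : ℕ) :
    ∀ (A : Finset V) (K : Finset ι) (u : V), Links G U T K → A ⊆ U → A.card = c + 1 → u ∈ A →
      c ≤ K.card → (∀ j ∈ K, Disjoint (T j) E) → (∀ a ∈ A, HasTail G a E m) →
      ∃ l, IsPathList G (u :: l) ∧ 2 * c + m ≤ l.length ∧
        ∀ x ∈ l, (x ∈ A ∧ x ≠ u) ∨ (∃ j ∈ K, x ∈ T j) ∨ x ∈ E := by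
  induction c with
  | zero =>
    intro A K u _ hAU _ hu _ _ hE
    obtain ⟨l, hl, hlE, hlen, x, hx, hux⟩ := hE u hu
    refine ⟨l, hl.cons (fun hul => Finset.disjoint_left.1 hEU (hlE u hul) (hAU hu)) ?_, by omega,
      fun x hx => Or.inr (Or.inr (hlE x hx))⟩
    intro y hy
    exact Option.mem_unique (Option.mem_def.2 hx) hy ▸ hux
  | succ c ih =>
    intro A K u hK hAU hA hu hcK hKE hE
    obtain ⟨j, hj⟩ := Finset.card_pos.1 (show 0 < K.card by omega)
    have hA' : (A.erase u).card = c + 1 := by rw [Finset.card_erase_of_mem hu]; omega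
    obtain ⟨u', hu'⟩ := Finset.card_pos.1 (show 0 < (A.erase u).card by omega)
    have hu'A := Finset.mem_of_mem_erase hu'
    have hKj : K.erase j ⊆ K := Finset.erase_subset _ _
    obtain ⟨l', hl', hlen', hsup'⟩ := ih (A.erase u) (K.erase j) u' (hK.mono hKj)
      ((Finset.erase_subset _ _).trans hAU) hA' hu' (by rw [Finset.card_erase_of_mem hj]; omega)
      (fun i hi => hKE i (hKj hi)) (fun a ha => hE a (Finset.mem_of_mem_erase ha))
    obtain ⟨q, hq, hqT, ⟨x, hx, hux⟩, y, hy, hu'y⟩ := hK.link j hj u (hAU hu) u' (hAU hu'A)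
    have hqne : q ≠ [] := by rintro rfl; simp at hx
    have hqlen : 1 ≤ q.length := List.length_pos_of_ne_nil hqne
    have hqU : ∀ z ∈ q, z ∉ U := fun z hz => Finset.disjoint_left.1 (hK.disjU j hj) (hqT z hz)
    have hl'u : ∀ z ∈ u' :: l', (z ∈ A ∧ z ≠ u) ∨ (∃ i ∈ K.erase j, z ∈ T i) ∨ z ∈ E := by
      intro z hz
      rcases List.mem_cons.1 hz with rfl | hz
      · exact Or.inl ⟨hu'A, Finset.ne_of_mem_erase hu'⟩
      · rcases hsup' z hz with h | h | h
        · exact Or.inl ⟨Finset.mem_of_mem_erase h.1, Finset.ne_of_mem_erase h.1⟩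
        · exact Or.inr (Or.inl h)
        · exact Or.inr (Or.inr h)
    refine ⟨q ++ u' :: l', IsPathList.cons (hq.append hl' ?_ ?_) ?_ ?_, ?_, ?_⟩
    · intro z hz hz'
      rcases hl'u z hz' with h | ⟨i, hi, h⟩ | h
      · exact hqU z hz (hAU h.1)
      · exact Finset.disjoint_left.1 (hK.disj i (hKj hi) j hj (Finset.ne_of_mem_erase hi)) h
          (hqT z hz)
      · exact Finset.disjoint_left.1 (hKE j hj) (hqT z hz) h
    · intro z hz w hw
      rw [hy, Option.mem_some_iff] at hz
      rw [List.head?_cons, Option.mem_some_iff] at hw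
      exact hz ▸ hw ▸ hu'y.symm
    · intro hmem
      rcases List.mem_append.1 hmem with h | h
      · exact hqU u h (hAU hu)
      · rcases hl'u u h with h | ⟨i, hi, h⟩ | h
        · exact h.2 rfl
        · exact Finset.disjoint_left.1 (hK.disjU i (hKj hi)) h (hAU hu)
        · exact Finset.disjoint_left.1 hEU h (hAU hu)
    · intro z hz
      rw [List.head?_append, hx, Option.some_or, Option.mem_some_iff] at hz
      exact hz ▸ hux
    · rw [List.length_append, List.length_cons]; omega
    · intro z hz
      rcases List.mem_append.1 hz with h | h
      · exact Or.inr (Or.inl ⟨j, hj, hqT z h⟩)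
      · rcases hl'u z h with h | ⟨i, hi, h⟩ | h
        · exact Or.inl h
        · exact Or.inr (Or.inl ⟨i, hKj hi, h⟩)
        · exact Or.inr (Or.inr h)

theorem Links.exists_path {E F : Finset V} {m m' c : ℕ} {K : Finset ι} (hK : Links G U T K)
    (hEU : Disjoint E U) (hFU : Disjoint F U) (hEF : Disjoint E F) {u : V} (hu : u ∈ U)
    (hU : U.card = c + 1) (hcK : c ≤ K.card) (hKE : ∀ j ∈ K, Disjoint (T j) E)
    (hKF : ∀ j ∈ K, Disjoint (T j) F) (hE : ∀ a ∈ U, HasTail G a E m) (hF : HasTail G u F m') :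
    ∃ l, IsPathList G l ∧ m' + 1 + 2 * c + m ≤ l.length ∧
      ∀ x ∈ l, x ∈ U ∨ (∃ j ∈ K, x ∈ T j) ∨ x ∈ E ∨ x ∈ F := by
  obtain ⟨l, hl, hlen, hsup⟩ := Links.exists_path_from hEU c U K u hK subset_rfl hU hu hcK hKE hE
  obtain ⟨q, hq, hqF, hqlen, x, hx, hux⟩ := hF
  have hsup' : ∀ z ∈ u :: l, z ∈ U ∨ (∃ j ∈ K, z ∈ T j) ∨ z ∈ E := by
    intro z hz
    rcases List.mem_cons.1 hz with rfl | hz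
    · exact Or.inl hu
    · rcases hsup z hz with h | h | h
      exacts [Or.inl h.1, Or.inr (Or.inl h), Or.inr (Or.inr h)]
  refine ⟨q.reverse ++ u :: l, hq.reverse.append hl ?_ ?_, ?_, ?_⟩
  · intro z hz hz'
    have hzF := hqF z (List.mem_reverse.1 hz)
    rcases hsup' z hz' with h | ⟨j, hj, h⟩ | h
    · exact Finset.disjoint_left.1 hFU hzF h
    · exact Finset.disjoint_left.1 (hKF j hj) h hzF
    · exact Finset.disjoint_left.1 hEF h hzF
  · intro z hz w hw
    rw [List.getLast?_reverse, hx, Option.mem_some_iff] at hz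
    rw [List.head?_cons, Option.mem_some_iff] at hw
    exact hz ▸ hw ▸ hux.symm
  · rw [List.length_append, List.length_cons, List.length_reverse]; omega
  · intro z hz
    rcases List.mem_append.1 hz with h | h
    · exact Or.inr (Or.inr (Or.inr (hqF z (List.mem_reverse.1 h))))
    · rcases hsup' z h with h | h | h
      exacts [Or.inl h, Or.inr (Or.inl h), Or.inr (Or.inr (Or.inl h))]

/-- Disjoint paths with prescribed numbers of vertices, where the `i`-th path either uses `c i`
vertices of `U` or lies inside one of the sets `T j`. -/
theorem Links.exists_disjoint_paths {κ : Type*} [Fintype κ] {K : Finset ι} (hK : Links G U T K)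
    {r : ℕ} (ht : ∀ j ∈ K, ∀ u ∈ U, HasTail G u (T j) r) (p c : κ → ℕ) (hc : ∑ i, c i ≤ U.card)
    (hcK : ∑ i, (c i + 1) ≤ K.card)
    (hp : ∀ i, (1 ≤ c i ∧ p i + 1 ≤ 2 * r + 2 * c i) ∨
      ∀ j ∈ K, ∃ l, IsPathList G l ∧ (∀ x ∈ l, x ∈ T j) ∧ p i ≤ l.length) :
    ∃ L : κ → List V, (∀ i, IsPathList G (L i)) ∧ (∀ i, p i ≤ (L i).length) ∧
      (∀ i, ∀ x ∈ L i, x ∈ U ∨ ∃ j ∈ K, x ∈ T j) ∧ ∀ i j, i ≠ j → ∀ x ∈ L i, x ∉ L j := by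
  obtain ⟨A, hAU, hAc, hAd⟩ := exists_disjoint_subsets U c hc
  obtain ⟨B, hBK, hBc, hBd⟩ := exists_disjoint_subsets K (fun i => c i + 1) hcK
  have key : ∀ i, ∃ l, IsPathList G l ∧ p i ≤ l.length ∧
      ∀ x ∈ l, x ∈ A i ∨ ∃ j ∈ B i, x ∈ T j := by
    intro i
    rcases hp i with ⟨hci, hpi⟩ | h
    · obtain ⟨u, hu⟩ := Finset.card_pos.1 (show 0 < (A i).card by rw [hAc]; omega)
      obtain ⟨e, he, f, hf, hef⟩ := Finset.one_lt_card.1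
        (show 1 < (B i).card by rw [hBc]; omega)
      have hKi : Links G (A i) T (((B i).erase e).erase f) := (hK.mono
        (((Finset.erase_subset _ _).trans (Finset.erase_subset _ _)).trans (hBK i))).anti (hAU i)
      obtain ⟨l, hl, hlen, hsup⟩ := hKi.exists_path (E := T e) (F := T f) (m := r) (m' := r)
        (c := c i - 1)
        ((hK.disjU e (hBK i he)).mono_right (hAU i)) ((hK.disjU f (hBK i hf)).mono_right (hAU i))
        (hK.disj e (hBK i he) f (hBK i hf) hef) hu (by rw [hAc]; omega)
        (by rw [Finset.card_erase_of_mem (Finset.mem_erase.2 ⟨hef.symm, hf⟩),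
              Finset.card_erase_of_mem he, hBc]; omega)
        (fun j hj => hK.disj j (hBK i (Finset.mem_of_mem_erase (Finset.mem_of_mem_erase hj))) e
          (hBK i he) (Finset.ne_of_mem_erase (Finset.mem_of_mem_erase hj)))
        (fun j hj => hK.disj j (hBK i (Finset.mem_of_mem_erase (Finset.mem_of_mem_erase hj))) f
          (hBK i hf) (Finset.ne_of_mem_erase hj))
        (fun a ha => ht e (hBK i he) a (hAU i ha)) (ht f (hBK i hf) u (hAU i hu))
      refine ⟨l, hl, by omega, fun x hx => ?_⟩
      rcases hsup x hx with h | ⟨j, hj, h⟩ | h | h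
      · exact Or.inl h
      · exact Or.inr ⟨j, Finset.mem_of_mem_erase (Finset.mem_of_mem_erase hj), h⟩
      · exact Or.inr ⟨e, he, h⟩
      · exact Or.inr ⟨f, hf, h⟩
    · obtain ⟨j, hj⟩ := Finset.card_pos.1 (show 0 < (B i).card by rw [hBc]; omega)
      obtain ⟨l, hl, hlT, hlen⟩ := h j (hBK i hj)
      exact ⟨l, hl, hlen, fun x hx => Or.inr ⟨j, hj, hlT x hx⟩⟩
  choose L hL hlen hsup using key
  refine ⟨L, hL, hlen, ?_, ?_⟩
  · intro i x hx
    rcases hsup i x hx with h | ⟨j, hj, h⟩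
    · exact Or.inl (hAU i h)
    · exact Or.inr ⟨j, hBK i hj, h⟩
  · intro i j hij x hx hx'
    rcases hsup i x hx with h | ⟨a, ha, h⟩ <;> rcases hsup j x hx' with h' | ⟨b, hb, h'⟩
    · exact Finset.disjoint_left.1 (hAd i j hij) h h'
    · exact Finset.disjoint_left.1 (hK.disjU b (hBK j hb)) h' (hAU i h)
    · exact Finset.disjoint_left.1 (hK.disjU a (hBK i ha)) h (hAU j h')
    · by_cases hab : a = b
      · subst hab
        exact Finset.disjoint_left.1 (hBd i j hij) ha hb
      · exact Finset.disjoint_left.1 (hK.disj a (hBK i ha) b (hBK j hb) hab) h h'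

end Packing

section Components

variable {V : Type*} {G : SimpleGraph V}

/-- The vertex sets of the connected components of `G[R]`. -/
noncomputable def comps (G : SimpleGraph V) (R : Finset V) : Finset (Finset V) :=
  R.powerset.filter (IsComp G R)

theorem mem_comps {R C : Finset V} : C ∈ comps G R ↔ IsComp G R C := by
  rw [comps, Finset.mem_filter, Finset.mem_powerset]
  exact ⟨fun h => h.2, fun h => ⟨h.subset, h⟩⟩

theorem many_or_large_comps (R : Finset V) {B n : ℕ} (hn : 0 < n) (hR : B * n ≤ R.card) :
    B ≤ (comps G R).card ∨ ∃ C, IsComp G R C ∧ n ≤ C.card := by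
  by_contra! hcon
  have h1 : R ⊆ (comps G R).biUnion id := by
    intro x hx
    obtain ⟨C, hC, hxC⟩ := exists_isComp G hx
    exact Finset.mem_biUnion.2 ⟨C, mem_comps.2 hC, hxC⟩
  have h2 : R.card ≤ (comps G R).card * n := (Finset.card_le_card h1).trans
    (Finset.card_biUnion_le_card_mul _ _ _ fun C hC => (hcon.2 C (mem_comps.1 hC)).le)
  have h3 : (comps G R).card * n < B * n := Nat.mul_lt_mul_of_pos_right hcon.1 hn
  omega

/-- A number of vertices that forces a connected graph without a path on more than `d` vertices
from some vertex to fall apart into `B` components after deletion of at most `d` vertices. -/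
def compsBound (B : ℕ) : ℕ → ℕ
  | 0 => 1
  | d + 1 => B * compsBound B d + 1

theorem compsBound_pos (B d : ℕ) : 0 < compsBound B d := by
  cases d <;> simp [compsBound]

theorem exists_many_comps_of_isComp (S : Finset V) (B d : ℕ) : ∀ (A T : Finset V) (v : V),
    IsComp G (S \ A) T → v ∈ T →
    (∀ l, IsPathList G (v :: l) → (∀ x ∈ l, x ∈ T) → l.length < d) → compsBound B d ≤ T.card →
    ∃ A', A'.card ≤ A.card + d ∧ B ≤ (comps G (S \ A')).card := by
  induction d with
  | zero =>
    intro A T v _ _ h _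
    exact absurd (h [] (isPathList_singleton G v) (by simp)) (by simp)
  | succ d ih =>
    intro A T v hT hv hpath hcard
    have hsub : ∀ C, IsComp G (T.erase v) C → IsComp G (S \ insert v A) C := by
      intro C hC
      refine ⟨hC.nonempty, ?_, hC.conn, ?_⟩
      · intro x hx
        have h1 := Finset.mem_erase.1 (hC.subset hx)
        have h2 := Finset.mem_sdiff.1 (hT.subset h1.2)
        exact Finset.mem_sdiff.2 ⟨h2.1, by simp [h1.1, h2.2]⟩
      · intro x hx y hy hxy
        rw [Finset.mem_sdiff, Finset.mem_insert, not_or] at hy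
        exact hC.closed x hx y (Finset.mem_erase.2 ⟨hy.2.1, hT.closed x
          (Finset.mem_of_mem_erase (hC.subset hx)) y (Finset.mem_sdiff.2 ⟨hy.1, hy.2.2⟩) hxy⟩) hxy
    have hins : (insert v A).card ≤ A.card + 1 := Finset.card_insert_le _ _
    rcases many_or_large_comps (G := G) (T.erase v) (compsBound_pos B d)
      (show B * compsBound B d ≤ _ by
        rw [Finset.card_erase_of_mem hv]; simp only [compsBound] at hcard; omega) with h | h
    · refine ⟨insert v A, by omega, h.trans (Finset.card_le_card fun C hC => ?_)⟩
      exact mem_comps.2 (hsub C (mem_comps.1 hC))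
    · obtain ⟨C, hC, hCcard⟩ := h
      have hCT : C ⊆ T := hC.subset.trans (Finset.erase_subset _ _)
      have hvC : v ∉ C := fun h => (Finset.mem_erase.1 (hC.subset h)).1 rfl
      obtain ⟨v', hv', hadj⟩ : ∃ v' ∈ C, G.Adj v' v := by
        by_contra! hno
        refine hvC ?_
        rw [hT.conn C hCT hC.nonempty fun x hx y hy hxy => hC.closed x hx y
          (Finset.mem_erase.2 ⟨by rintro rfl; exact hno x hx hxy, hy⟩) hxy]
        exact hv
      obtain ⟨A', h1, h2⟩ := ih (insert v A) C v' (hsub C hC) hv' (by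
        intro l hl hlC
        have hmem : ∀ x ∈ v' :: l, x ∈ C := by
          intro x hx
          rcases List.mem_cons.1 hx with rfl | hx
          exacts [hv', hlC x hx]
        have := hpath (v' :: l) (hl.cons (fun h => hvC (hmem v h)) (by
          intro z hz
          rw [List.head?_cons, Option.mem_some_iff] at hz
          exact hz ▸ hadj.symm)) (fun x hx => hCT (hmem x hx))
        simp only [List.length_cons] at this
        omega) hCcard
      exact ⟨A', by omega, h2⟩

theorem exists_many_comps (S : Finset V) (B d : ℕ)
    (hpath : ∀ l, IsPathList G l → l.length ≤ d) (hS : B * compsBound B d ≤ S.card) :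
    ∃ A, A.card ≤ d ∧ B ≤ (comps G (S \ A)).card := by
  rcases many_or_large_comps (G := G) S (compsBound_pos B d) hS with h | ⟨C, hC, hCcard⟩
  · exact ⟨∅, by simp, by simpa using h⟩
  · obtain ⟨v, hv⟩ := hC.nonempty
    simpa using exists_many_comps_of_isComp S B d ∅ C v (by simpa using hC) hv
      (fun l hl _ => by simpa using hpath _ hl) hCcard

/-- In a large graph without long paths there is a set `U` with many components of `G - U`
each of which has neighbourhood `U`. -/
theorem exists_common_boundary (S : Finset V) (M d : ℕ)
    (hpath : ∀ l, IsPathList G l → l.length ≤ d)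
    (hS : 2 ^ d * M * compsBound (2 ^ d * M) d ≤ S.card) :
    ∃ U ⊆ S, ∃ 𝒯 : Finset (Finset V), M ≤ 𝒯.card ∧
      ∀ T ∈ 𝒯, IsComp G (S \ U) T ∧ ∀ u ∈ U, ∃ x ∈ T, G.Adj u x := by
  obtain ⟨A, hA, hcomps⟩ := exists_many_comps S _ d hpath hS
  obtain ⟨U, hU, hUM⟩ := Finset.exists_le_card_fiber_of_mul_le_card_of_maps_to
    (s := comps G (S \ A)) (t := (A ∩ S).powerset) (n := M)
    (f := fun T => (A ∩ S).filter fun u => ∃ x ∈ T, G.Adj u x)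
    (fun T _ => Finset.mem_powerset.2 (Finset.filter_subset _ _)) ⟨∅, Finset.empty_mem_powerset _⟩ (by
      refine le_trans (Nat.mul_le_mul_right _ ?_) hcomps
      rw [Finset.card_powerset]
      exact Nat.pow_le_pow_right (by norm_num)
        ((Finset.card_le_card Finset.inter_subset_left).trans hA))
  have hUA := Finset.mem_powerset.1 hU
  refine ⟨U, hUA.trans Finset.inter_subset_right, _, hUM, ?_⟩
  intro T hT
  obtain ⟨hT1, hT2⟩ := Finset.mem_filter.1 hT
  have hT1 := mem_comps.1 hT1
  refine ⟨⟨hT1.nonempty, hT1.subset.trans (Finset.sdiff_subset_sdiff subset_rfl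
    (hUA.trans Finset.inter_subset_left)), hT1.conn, ?_⟩, ?_⟩
  · intro x hx y hy hxy
    obtain ⟨hyS, hyU⟩ := Finset.mem_sdiff.1 hy
    refine hT1.closed x hx y (Finset.mem_sdiff.2 ⟨hyS, fun hyA => hyU ?_⟩) hxy
    rw [← hT2]
    exact Finset.mem_filter.2 ⟨Finset.mem_inter.2 ⟨hyA, hyS⟩, x, hx, hxy.symm⟩
  · intro u hu
    rw [← hT2] at hu
    exact (Finset.mem_filter.1 hu).2

theorem links_of_common_boundary {S U : Finset V} {𝒯 : Finset (Finset V)}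
    (h : ∀ T ∈ 𝒯, IsComp G (S \ U) T ∧ ∀ u ∈ U, ∃ x ∈ T, G.Adj u x) : Links G U id 𝒯 := by
  refine ⟨?_, ?_, ?_⟩
  · intro T hT
    exact Finset.disjoint_left.2 fun x hx hxU => (Finset.mem_sdiff.1 ((h T hT).1.subset hx)).2 hxU
  · intro T hT T' hT' hne
    exact Finset.disjoint_left.2 fun x hx hx' => hne ((h T hT).1.eq_of_mem (h T' hT').1 hx hx')
  · intro T hT u hu u' hu'
    obtain ⟨x, hx, hux⟩ := (h T hT).2 u hu
    obtain ⟨y, hy, huy⟩ := (h T hT).2 u' hu'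
    obtain ⟨l, hl, hlT, h1, h2⟩ := (h T hT).1.conn.exists_path hx hy
    exact ⟨l, hl, hlT, ⟨x, h1, hux⟩, y, h2, huy⟩

theorem hasTail_of_minDegree {T : Finset V} {u : V} (hu : ∃ x ∈ T, G.Adj u x) {δ r : ℕ}
    (hδ : ∀ x ∈ T, δ ≤ degIn G T x) (hr : r ≤ δ + 1) : HasTail G u T r := by
  obtain ⟨x, hx, hux⟩ := hu
  obtain ⟨l, hl, hlT, h1, h2⟩ := exists_path_of_minDegree hδ hx
  exact ⟨l, hl, hlT, hr.trans h2, x, h1, hux⟩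

theorem IsComp.degIn_le {S U T : Finset V} (hT : IsComp G (S \ U) T) {x : V} (hx : x ∈ T) :
    degIn G S x ≤ degIn G T x + U.card := by
  unfold degIn
  calc (S.filter (G.Adj x)).card ≤ (T.filter (G.Adj x) ∪ U).card := by
        refine Finset.card_le_card fun y hy => ?_
        obtain ⟨hyS, hxy⟩ := Finset.mem_filter.1 hy
        by_cases hyU : y ∈ U
        · exact Finset.mem_union_right _ hyU
        · exact Finset.mem_union_left _ (Finset.mem_filter.2
            ⟨hT.closed x hx y (Finset.mem_sdiff.2 ⟨hyS, hyU⟩) hxy, hxy⟩)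
    _ ≤ _ := Finset.card_union_le _ _

theorem IsComp.degIn_sdiff_le {S U T : Finset V} (hT : IsComp G (S \ U) T) {x : V} (hx : x ∈ T) :
    degIn G (S \ T) x ≤ U.card := by
  refine Finset.card_le_card fun y hy => ?_
  obtain ⟨hyS, hxy⟩ := Finset.mem_filter.1 hy
  rw [Finset.mem_sdiff] at hyS
  by_contra hyU
  exact hyS.2 (hT.closed x hx y (Finset.mem_sdiff.2 ⟨hyS.1, hyU⟩) hxy)

theorem CutConn.one_le_degIn {T : Finset V} (hT : CutConn G T) (hcard : 2 ≤ T.card) {x : V}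
    (hx : x ∈ T) : 1 ≤ degIn G T x := by
  by_contra! h
  have h0 : T.filter (G.Adj x) = ∅ := Finset.card_eq_zero.1 (by unfold degIn at h; omega)
  have := hT {x} (by simpa using hx) (by simp) (fun y hy z hz hyz => by
    rw [Finset.mem_singleton] at hy
    subst hy
    exact absurd (Finset.mem_filter.2 ⟨hz, hyz⟩) (by rw [h0]; simp))
  rw [← this] at hcard
  simp at hcard

end Components

section Dense

variable {V : Type*} {G : SimpleGraph V} {k : ℕ} {p : Fin k → ℕ}

/-- Every set `T ⊆ S` meets at least `(m - 5 / 4) |T|` edges of `G[S]`. -/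
def LocallyDense (G : SimpleGraph V) (S : Finset V) (m : ℕ) : Prop :=
  ∀ T ⊆ S, 4 * m * T.card + 2 * degSum G (S \ T) ≤ 2 * degSum G S + 5 * T.card

theorem LocallyDense.le_degIn {S : Finset V} {m : ℕ} (h : LocallyDense G S m) {x : V}
    (hx : x ∈ S) : m ≤ degIn G S x + 1 := by
  have h1 := h {x} (by simpa using hx)
  have h2 : degSum G S = degSum G (S.erase x) + 2 * degIn G S x := by
    conv_lhs => rw [← Finset.insert_erase hx]
    rw [degSum_insert G (Finset.notMem_erase x S), degIn_erase_self]
  rw [Finset.sdiff_singleton_eq_erase, Finset.card_singleton] at h1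
  omega

theorem LocallyDense.le_card {S U T : Finset V} {m : ℕ} (h : LocallyDense G S m)
    (hT : IsComp G (S \ U) T) : 2 * m ≤ T.card + 1 + 2 * U.card := by
  have hTS : T ⊆ S := hT.subset.trans Finset.sdiff_subset
  have h1 := h T hTS
  have h2 := degSum_union G (S := S \ T) (T := T) Finset.sdiff_disjoint
  rw [Finset.sdiff_union_of_subset hTS] at h2
  have h3 : ∑ x ∈ T, degIn G (S \ T) x ≤ T.card * U.card := by
    rw [← smul_eq_mul]
    exact Finset.sum_le_card_nsmul _ _ _ fun x hx => hT.degIn_sdiff_le hx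
  have h4 := degSum_le G T
  have hpos : 0 < T.card := Finset.card_pos.2 hT.nonempty
  obtain ⟨t, ht⟩ : ∃ t, T.card = t + 1 := ⟨T.card - 1, by omega⟩
  rw [ht, Nat.add_sub_cancel] at h4
  rw [ht] at h1 h3 ⊢
  have h5 : (t + 1) * (4 * m) ≤ (t + 1) * (2 * t + 4 * U.card + 5) := by nlinarith
  have := Nat.le_of_mul_le_mul_left h5 (Nat.succ_pos t)
  omega

theorem sum_sub_le {a : Fin k → ℕ} (hk : 2 ≤ k) (ha : ∀ i, 1 ≤ a i) {r : ℕ} (hr : 2 ≤ r) :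
    ∑ i, (a i + 1 - r) ≤ ∑ i, a i - r := by
  by_cases h : ∃ i, r ≤ a i
  · obtain ⟨i, hi⟩ := h
    have : Nontrivial (Fin k) := Fin.nontrivial_iff_two_le.2 hk
    obtain ⟨j, hj⟩ := exists_ne i
    have hjm : j ∈ Finset.univ.erase i := Finset.mem_erase.2 ⟨hj, Finset.mem_univ j⟩
    rw [← Finset.add_sum_erase Finset.univ _ (Finset.mem_univ i),
      ← Finset.add_sum_erase Finset.univ a (Finset.mem_univ i)]
    have h1 : ∑ x ∈ Finset.univ.erase i, (a x + 1 - r) + 1 ≤ ∑ x ∈ Finset.univ.erase i, a x := by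
      refine Nat.succ_le_of_lt (Finset.sum_lt_sum (fun x _ => by omega) ⟨j, hjm, ?_⟩)
      have := ha j
      omega
    omega
  · push Not at h
    rw [Finset.sum_eq_zero fun i _ => by have := h i; omega]
    exact Nat.zero_le _

theorem exists_common_neighbors_of_locallyDense (hk : 2 ≤ k) (hp : ∀ i, 3 ≤ p i)
    (hH : ¬ ∀ i, p i = 3) {ℓ : ℕ} (hℓ : ℓ = ∑ i, p i / 2) {S : Finset V}
    (hfree : (linearForest p).Free G) (hS : LocallyDense G S ℓ) {M : ℕ}
    (hlarge : 2 ^ (∑ i, p i) * (M + ∑ i, (p i + 1)) *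
      compsBound (2 ^ (∑ i, p i) * (M + ∑ i, (p i + 1))) (∑ i, p i) ≤ S.card) :
    ∃ U : Finset V, U.card = ℓ - 1 ∧ ∃ W : Finset V, M ≤ W.card ∧ Disjoint W U ∧
      ∀ w ∈ W, ∀ u ∈ U, G.Adj u w := by
  have hpath : ∀ l, IsPathList G l → l.length ≤ ∑ i, p i := by
    intro l hl
    by_contra! h
    exact hfree (linearForest_isContained_of_long_list l hl h.le)
  obtain ⟨U, hUS, 𝒯, h𝒯, hcomp⟩ := exists_common_boundary S _ _ hpath hlarge
  have hlinks := links_of_common_boundary hcomp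
  have hpack : ∀ (𝒦 : Finset (Finset V)) (r : ℕ) (c : Fin k → ℕ), 𝒦 ⊆ 𝒯 →
      ∑ i, (p i + 1) ≤ 𝒦.card → (∀ T ∈ 𝒦, ∀ u ∈ U, HasTail G u T r) → (∀ i, c i ≤ p i) →
      ∑ i, c i ≤ U.card → (∀ i, (1 ≤ c i ∧ p i + 1 ≤ 2 * r + 2 * c i) ∨
        ∀ T ∈ 𝒦, ∃ l, IsPathList G l ∧ (∀ x ∈ l, x ∈ T) ∧ p i ≤ l.length) → False := by
    intro 𝒦 r c h𝒦 hcard htail hcp hc hi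
    obtain ⟨L, h1, h2, -, h3⟩ := (hlinks.mono h𝒦).exists_disjoint_paths htail p c hc
      ((Finset.sum_le_sum fun i _ => by have := hcp i; omega).trans hcard) hi
    exact hfree (linearForest_isContained_of_lists L h1 h2 h3)
  have hdeg : ∀ T ∈ 𝒯, ∀ x ∈ T, ℓ - 1 - U.card ≤ degIn G T x := by
    intro T hT x hx
    have h1 := (hcomp T hT).1.degIn_le hx
    have h2 := hS.le_degIn (Finset.mem_sdiff.1 ((hcomp T hT).1.subset hx)).1
    omega
  have h𝒯' : ∑ i, (p i + 1) ≤ 𝒯.card := by omega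
  rcases lt_trichotomy U.card (ℓ - 1) with hlt | heq | hgt
  · exfalso
    refine hpack 𝒯 (ℓ - U.card) (fun i => p i / 2 + 1 - (ℓ - U.card)) subset_rfl h𝒯'
      (fun T hT u hu => hasTail_of_minDegree ((hcomp T hT).2 u hu) (hdeg T hT) (by omega))
      (fun i => by omega) ?_ ?_
    · have := sum_sub_le (a := fun i => p i / 2) hk (fun i => by have := hp i; omega)
        (r := ℓ - U.card) (by omega)
      omega
    · intro i
      by_cases hi : 1 ≤ p i / 2 + 1 - (ℓ - U.card)
      · left
        exact ⟨hi, by omega⟩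
      · right
        intro T hT
        have h1 := hS.le_card (hcomp T hT).1
        obtain ⟨l, hl, hlT, hlen⟩ := (hcomp T hT).1.conn.exists_long_path (hdeg T hT) (by omega)
        exact ⟨l, hl, hlT, by omega⟩
  · refine ⟨U, heq, ?_⟩
    have hsplit := Finset.card_filter_add_card_filter_not (s := 𝒯) (fun T => T.card = 1)
    by_cases hM : M ≤ (𝒯.filter fun T => T.card = 1).card
    · refine ⟨(𝒯.filter fun T => T.card = 1).biUnion id, ?_, ?_, ?_⟩
      · rw [Finset.card_biUnion]
        · refine hM.trans ?_
          rw [Finset.card_eq_sum_ones]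
          exact Finset.sum_le_sum fun T hT => (Finset.mem_filter.1 hT).2.ge
        · intro T hT T' hT' hne
          exact hlinks.disj T (Finset.mem_filter.1 hT).1 T' (Finset.mem_filter.1 hT').1 hne
      · rw [Finset.disjoint_biUnion_left]
        exact fun T hT => hlinks.disjU T (Finset.mem_filter.1 hT).1
      · intro w hw u hu
        obtain ⟨T, hT, hwT⟩ := Finset.mem_biUnion.1 hw
        obtain ⟨hT, hT1⟩ := Finset.mem_filter.1 hT
        obtain ⟨x, hx⟩ := Finset.card_eq_one.1 hT1
        obtain ⟨y, hy, huy⟩ := (hcomp T hT).2 u hu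
        simp only [id, hx, Finset.mem_singleton] at hwT hy
        rw [hwT, ← hy]
        exact huy
    · exfalso
      have hsub := Finset.filter_subset (fun T => ¬ T.card = 1) 𝒯
      have hdeg1 : ∀ T ∈ 𝒯.filter (fun T => ¬ T.card = 1), ∀ x ∈ T, 1 ≤ degIn G T x := by
        intro T hT x hx
        obtain ⟨hT, hT1⟩ := Finset.mem_filter.1 hT
        have : 0 < T.card := Finset.card_pos.2 ⟨x, hx⟩
        exact (hcomp T hT).1.conn.one_le_degIn (by omega) hx
      refine hpack (𝒯.filter fun T => ¬ T.card = 1) 2 (fun i => max 1 (p i / 2 - 1))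
        hsub (by omega)
        (fun T hT u hu => hasTail_of_minDegree ((hcomp T (hsub hT)).2 u hu) (hdeg1 T hT) le_rfl)
        (fun i => by have := hp i; omega) ?_ (fun i => Or.inl ⟨by omega, by omega⟩)
      push Not at hH
      obtain ⟨i, hi⟩ := hH
      have : ∑ i, max 1 (p i / 2 - 1) < ∑ i, p i / 2 :=
        Finset.sum_lt_sum (fun j _ => by have := hp j; omega)
          ⟨i, Finset.mem_univ i, by have := hp i; omega⟩
      omega
  · exfalso
    exact hpack 𝒯 1 (fun i => p i / 2) subset_rfl h𝒯'
      (fun T hT u hu => hasTail_of_minDegree ((hcomp T hT).2 u hu) (δ := 0) (fun _ _ => Nat.zero_le _)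
        le_rfl)
      (fun i => by omega) (by omega) (fun i => Or.inl ⟨by have := hp i; omega, by omega⟩)

end Dense

section Extraction

variable {V : Type*} [Fintype V]

theorem exists_locallyDense (G : SimpleGraph V) {ℓ b : ℕ} (hℓ : 1 ≤ ℓ)
    (hn : 2 * b ^ 2 + 5 * b + 4 * ℓ ^ 2 ≤ Fintype.card V)
    (he : (ℓ - 1) * (Fintype.card V - ℓ + 1) ≤ G.edgeFinset.card) :
    ∃ S, LocallyDense G S ℓ ∧ b ≤ S.card := by
  let Φ : Finset V → ℤ := fun S => 2 * degSum G S + 5 * S.card - 4 * ℓ * S.card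
  obtain ⟨S, -, hS⟩ := Finset.exists_max_image (Finset.univ : Finset (Finset V)) Φ ⟨∅, by simp⟩
  refine ⟨S, ?_, ?_⟩
  · intro T hT
    have h1 := hS (S \ T) (Finset.mem_univ _)
    have h2 : (S \ T).card + T.card = S.card := Finset.card_sdiff_add_card_eq_card hT
    simp only [Φ] at h1
    zify at h2 ⊢
    rw [← h2] at h1
    linarith
  · have h1 := hS Finset.univ (Finset.mem_univ _)
    simp only [Φ, degSum_univ, Finset.card_univ] at h1
    obtain ⟨m, rfl⟩ : ∃ m, ℓ = m + 1 := ⟨ℓ - 1, by omega⟩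
    obtain ⟨t, ht⟩ : ∃ t, Fintype.card V = m + 1 + t :=
      ⟨Fintype.card V - (m + 1), (Nat.add_sub_cancel' (by nlinarith)).symm⟩
    have h2 := (degSum_le G S).trans (Nat.mul_le_mul_left _ (Nat.sub_le _ 1))
    by_contra! hlt
    rw [ht] at he h1 hn
    simp only [Nat.add_sub_cancel, Nat.add_sub_cancel_left] at he
    push_cast at h1
    zify at he h2 hn hlt
    have h3 : (S.card : ℤ) * S.card < b ^ 2 := by nlinarith
    have h4 : (0 : ℤ) ≤ (m : ℤ) * S.card := by positivity
    nlinarith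

end Extraction

section Count

variable {V : Type*} {G : SimpleGraph V} {U : Finset V}

theorem degIn_lt_of_not_adj {x u : V} (hu : u ∈ U) (h : ¬ G.Adj u x) : degIn G U x < U.card :=
  Finset.card_lt_card ⟨Finset.filter_subset _ _,
    fun hsub => h (Finset.mem_filter.1 (hsub hu)).2.symm⟩

theorem degIn_eq_zero_of_not_adj {x : V} (h : ∀ u ∈ U, ¬ G.Adj u x) : degIn G U x = 0 :=
  Finset.card_eq_zero.2 (Finset.filter_eq_empty_iff.2 fun u hu hadj => h u hu hadj.symm)

/-- If every vertex outside `U` can be deleted at a cost of at most `|U|` edges, then the graph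
has at most `|U|` edges per vertex besides those inside `U`. -/
theorem degSum_union_le (hU : U.Nonempty)
    (h1 : ∀ u ∈ U, ∀ x y z, x ∉ U → y ∉ U → z ∉ U → G.Adj u x → G.Adj x y → G.Adj y z → z = x)
    (h2 : ∀ S : Finset V, S.Nonempty → Disjoint S U → ∃ x ∈ S, degIn G S x ≤ U.card)
    (h3 : ∀ x y, x ∉ U → y ∉ U → (∀ u ∈ U, G.Adj u x) → (∀ u ∈ U, G.Adj u y) → ¬ G.Adj x y)
    (S : Finset V) (hS : Disjoint S U) :
    degSum G (U ∪ S) ≤ degSum G U + 2 * (U.card * S.card) := by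
  induction hn : S.card generalizing S with
  | zero =>
    rw [Finset.card_eq_zero.1 hn]
    simp
  | succ n ih =>
    have hne : S.Nonempty := Finset.card_pos.1 (by omega)
    have hSU : ∀ x ∈ S, x ∉ U := fun x hx => Finset.disjoint_left.1 hS hx
    obtain ⟨x, hx, hdeg⟩ : ∃ x ∈ S, degIn G U x + degIn G S x ≤ U.card := by
      by_cases h0 : ∃ x ∈ S, degIn G S x = 0
      · obtain ⟨x, hx, h0⟩ := h0
        exact ⟨x, hx, by rw [h0]; exact Finset.card_filter_le _ _⟩
      push Not at h0
      by_cases hatt : ∃ x ∈ S, ∃ u ∈ U, G.Adj u x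
      · obtain ⟨x, hx, u, hu, hux⟩ := hatt
        obtain ⟨y, hy⟩ := Finset.card_pos.1 (Nat.pos_of_ne_zero (h0 x hx))
        obtain ⟨hyS, hxy⟩ := Finset.mem_filter.1 hy
        have hle : ∀ a ∈ S, ∀ b ∈ S, G.Adj a b → (∃ v ∈ U, G.Adj v a) → degIn G S b ≤ 1 := by
          rintro a ha b hb hab ⟨v, hv, hva⟩
          refine Finset.card_le_one.2 fun c hc d hd => ?_
          rw [Finset.mem_filter] at hc hd
          rw [h1 v hv a b c (hSU a ha) (hSU b hb) (hSU c hc.1) hva hab hc.2,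
            h1 v hv a b d (hSU a ha) (hSU b hb) (hSU d hd.1) hva hab hd.2]
        have hy1 := hle x hx y hyS hxy ⟨u, hu, hux⟩
        by_cases hyatt : ∃ v ∈ U, G.Adj v y
        · have hx1 := hle y hyS x hx hxy.symm hyatt
          by_cases hfx : ∀ v ∈ U, G.Adj v x
          · have : ¬ ∀ v ∈ U, G.Adj v y := fun hfy => h3 x y (hSU x hx) (hSU y hyS) hfx hfy hxy
            push Not at this
            obtain ⟨v, hv, hvy⟩ := this
            have := degIn_lt_of_not_adj hv hvy
            exact ⟨y, hyS, by omega⟩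
          · push Not at hfx
            obtain ⟨v, hv, hvx⟩ := hfx
            have := degIn_lt_of_not_adj hv hvx
            exact ⟨x, hx, by omega⟩
        · push Not at hyatt
          have := degIn_eq_zero_of_not_adj hyatt
          have := Finset.card_pos.2 hU
          exact ⟨y, hyS, by omega⟩
      · push Not at hatt
        obtain ⟨x, hx, hle⟩ := h2 S hne hS
        exact ⟨x, hx, by rw [degIn_eq_zero_of_not_adj (hatt x hx)]; omega⟩
    have hS' : Disjoint (S.erase x) U := hS.mono_left (Finset.erase_subset _ _)
    have h4 := ih (S.erase x) hS' (by rw [Finset.card_erase_of_mem hx]; omega)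
    have h5 : U ∪ S = insert x (U ∪ S.erase x) := by
      rw [← Finset.union_insert, Finset.insert_erase hx]
    rw [h5, degSum_insert G (by simp [hSU x hx]), degIn_union G hS'.symm, degIn_erase_self]
    rw [mul_add U.card, mul_one]
    omega

end Count

section Structure

variable {V : Type*} {G : SimpleGraph V} {k : ℕ} {p : Fin k → ℕ} {ℓ : ℕ} {U W : Finset V}

theorem links_singleton (hWU : Disjoint W U) (hW : ∀ w ∈ W, ∀ u ∈ U, G.Adj u w) :
    Links G U (fun w => {w}) W := by
  refine ⟨?_, ?_, ?_⟩
  · intro w hw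
    simpa using Finset.disjoint_left.1 hWU hw
  · intro w _ w' _ hne
    simpa using hne
  · intro w hw u hu u' hu'
    exact ⟨[w], isPathList_singleton G w, by simp, ⟨w, rfl, hW w hw u hu⟩, w, rfl, hW w hw u' hu'⟩

theorem hasTail_singleton {u w : V} (h : G.Adj u w) : HasTail G u {w} 1 :=
  ⟨[w], isPathList_singleton G w, by simp, by simp, w, rfl, h⟩

theorem hasTail_pair {u x y : V} (h : G.Adj u x) (hxy : G.Adj x y) : HasTail G u {x, y} 2 :=
  ⟨[x, y], (isPathList_singleton G y).cons (by simpa using hxy.ne) (by simpa using hxy), by simp,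
    by simp, x, rfl, h⟩

theorem hasTail_triple {u x y z : V} (h : G.Adj u x) (hxy : G.Adj x y) (hyz : G.Adj y z)
    (hne : z ≠ x) : HasTail G u {x, y, z} 3 :=
  ⟨[x, y, z], ((isPathList_singleton G z).cons (by simpa using hyz.ne) (by simpa using hyz)).cons
    (by simpa using ⟨hxy.ne, hne.symm⟩) (by simpa using hxy), by simp, by simp, x, rfl, h⟩

/-- The setting of a graph without a copy of the linear forest in which `ℓ - 1` vertices have many
common neighbours. -/
structure Core (G : SimpleGraph V) (p : Fin k → ℕ) (ℓ : ℕ) (U W : Finset V) : Prop where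
  two_le : 2 ≤ k
  three_le : ∀ i, 3 ≤ p i
  sum_eq : ℓ = ∑ i, p i / 2
  free : (linearForest p).Free G
  card_U : U.card = ℓ - 1
  disj : Disjoint W U
  adj : ∀ w ∈ W, ∀ u ∈ U, G.Adj u w
  card_W : ∑ i, (p i + 1) + ∑ i, p i + 5 ≤ W.card

theorem Core.half_lt (h : Core G p ℓ U W) (i : Fin k) : p i / 2 + 1 ≤ ℓ := by
  have : Nontrivial (Fin k) := Fin.nontrivial_iff_two_le.2 h.two_le
  obtain ⟨j, hj⟩ := exists_ne i
  have h1 := Finset.add_le_sum (f := fun i => p i / 2) (fun i _ => Nat.zero_le _)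
    (Finset.mem_univ i) (Finset.mem_univ j) hj.symm
  rw [h.sum_eq]
  have := h.three_le j
  omega

theorem Core.no_cheap_path (h : Core G p ℓ U W) (i : Fin k) {l : List V} (hl : IsPathList G l)
    (hlen : p i ≤ l.length) (hlU : (U.filter fun u => u ∈ l).card + 1 ≤ p i / 2) : False := by
  set q := l.take (p i) with hq
  have hql : ∀ x ∈ q, x ∈ l := fun x hx => List.mem_of_mem_take hx
  have hqlen : q.length = p i := by rw [hq, List.length_take]; omega
  let c : Fin k → ℕ := Function.update (fun j => p j / 2) i 0
  have hL := ((links_singleton h.disj h.adj).anti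
    (Finset.filter_subset (fun u => u ∉ q) U)).mono (Finset.filter_subset (fun w => w ∉ q) W)
  have hsum : ∑ j, c j + p i / 2 = ℓ := by
    rw [Finset.sum_update_of_mem (Finset.mem_univ i), h.sum_eq, zero_add, add_comm,
      ← Finset.erase_eq, Finset.add_sum_erase _ (fun j => p j / 2) (Finset.mem_univ i)]
  have hcU : ∑ j, c j ≤ (U.filter fun u => u ∉ q).card := by
    have h1 := Finset.card_filter_add_card_filter_not (s := U) (fun u => u ∈ q)
    have h2 : (U.filter fun u => u ∈ q).card ≤ (U.filter fun u => u ∈ l).card :=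
      Finset.card_le_card fun u hu => by
        rw [Finset.mem_filter] at hu ⊢
        exact ⟨hu.1, hql u hu.2⟩
    have := h.card_U
    omega
  have hcle : ∀ j, c j ≤ p j := by
    intro j
    by_cases hj : j = i
    · subst hj; simp [c]
    · simp only [c, Function.update_of_ne hj]; omega
  have hcW : ∑ j, (c j + 1) ≤ (W.filter fun w => w ∉ q).card := by
    have h1 := Finset.card_filter_add_card_filter_not (s := W) (fun w => w ∈ q)
    have h2 : (W.filter fun w => w ∈ q).card ≤ q.length :=
      (Finset.card_le_card fun w hw => List.mem_toFinset.2 (Finset.mem_filter.1 hw).2).trans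
        (List.toFinset_card_le q)
    have h3 : ∑ j, (c j + 1) ≤ ∑ j, (p j + 1) :=
      Finset.sum_le_sum fun j _ => Nat.succ_le_succ (hcle j)
    have h4 : p i ≤ ∑ j, p j := Finset.single_le_sum (f := p) (fun _ _ => Nat.zero_le _)
      (Finset.mem_univ i)
    have := h.card_W
    omega
  obtain ⟨L, h1, h2, h3, h4⟩ := hL.exists_disjoint_paths (r := 1)
    (fun w hw u hu => hasTail_singleton
      (h.adj w (Finset.mem_filter.1 hw).1 u (Finset.mem_filter.1 hu).1))
    (Function.update p i 0) c hcU hcW (by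
      intro j
      by_cases hj : j = i
      · subst hj
        exact Or.inr fun _ _ => ⟨[], ⟨List.IsChain.nil, List.nodup_nil⟩, by simp, by simp⟩
      · left
        simp only [c, Function.update_of_ne hj]
        have := h.three_le j
        omega)
  have hLq : ∀ j, ∀ x ∈ L j, x ∉ q := by
    intro j x hx
    rcases h3 j x hx with hU | ⟨w, hw, hxw⟩
    · exact (Finset.mem_filter.1 hU).2
    · rw [Finset.mem_singleton.1 hxw]
      exact (Finset.mem_filter.1 hw).2
  refine h.free (linearForest_isContained_of_lists (Function.update L i q) ?_ ?_ ?_)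
  · intro j
    by_cases hj : j = i
    · subst hj; simpa using hl.take _
    · simpa [Function.update_of_ne hj] using h1 j
  · intro j
    by_cases hj : j = i
    · subst hj; simp [hqlen]
    · simpa [Function.update_of_ne hj] using h2 j
  · intro a b hab x hx hx'
    by_cases ha : a = i
    · subst ha
      rw [Function.update_self] at hx
      rw [Function.update_of_ne hab.symm] at hx'
      exact hLq b x hx' hx
    · rw [Function.update_of_ne ha] at hx
      by_cases hb : b = i
      · subst hb
        rw [Function.update_self] at hx'
        exact hLq a x hx hx'
      · rw [Function.update_of_ne hb] at hx'
        exact h4 a b hab x hx hx'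

theorem Core.no_special_path (h : Core G p ℓ U W) {i : Fin k} (hi : 4 ≤ p i) {u : V} (hu : u ∈ U)
    {E F : Finset V} (hEU : Disjoint E U) (hFU : Disjoint F U) (hEF : Disjoint E F)
    (hcard : E.card + F.card ≤ 4) {m m' : ℕ} (hE : ∀ a ∈ U, HasTail G a E m)
    (hF : HasTail G u F m') (hp : p i + 3 ≤ m' + m + 2 * (p i / 2)) : False := by
  have hhalf := h.half_lt i
  obtain ⟨A, huA, hAU, hA⟩ := Finset.exists_subsuperset_card_eq (s := {u}) (t := U)
    (n := p i / 2 - 2 + 1) (by simpa using hu) (by simp) (by rw [h.card_U]; omega)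
  have hL := ((links_singleton h.disj h.adj).anti hAU).mono
    (Finset.sdiff_subset (s := W) (t := E ∪ F))
  have hKEF : ∀ j ∈ W \ (E ∪ F), j ∉ E ∧ j ∉ F := by
    intro j hj
    have := (Finset.mem_sdiff.1 hj).2
    rwa [Finset.mem_union, not_or] at this
  obtain ⟨l, hl, hlen, hsup⟩ := hL.exists_path (hEU.mono_right hAU) (hFU.mono_right hAU) hEF
    (huA (Finset.mem_singleton_self u)) hA (by
      have h1 := Finset.le_card_sdiff (E ∪ F) W
      have h2 := Finset.card_union_le E F
      have h3 := h.card_W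
      have h4 : p i ≤ ∑ j, p j := Finset.single_le_sum (f := p) (fun _ _ => Nat.zero_le _)
        (Finset.mem_univ i)
      omega) (fun j hj => by simpa using (hKEF j hj).1) (fun j hj => by simpa using (hKEF j hj).2)
    (fun a ha => hE a (hAU ha)) hF
  refine h.no_cheap_path i hl (by omega) ?_
  have : (U.filter fun u => u ∈ l).card ≤ A.card := by
    refine Finset.card_le_card fun x hx => ?_
    obtain ⟨hxU, hxl⟩ := Finset.mem_filter.1 hx
    rcases hsup x hxl with h' | ⟨w, hw, h'⟩ | h' | h'
    · exact h'
    · rw [Finset.mem_singleton.1 h'] at hxU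
      exact absurd hxU (Finset.disjoint_left.1 h.disj (Finset.mem_sdiff.1 hw).1)
    · exact absurd hxU (Finset.disjoint_left.1 hEU h')
    · exact absurd hxU (Finset.disjoint_left.1 hFU h')
  omega

theorem Core.exists_mem_notMem (h : Core G p ℓ U W) {F : Finset V} (hF : F.card ≤ 3) :
    ∃ w ∈ W, w ∉ F :=
  Finset.exists_mem_notMem_of_card_lt_card (by have := h.card_W; omega)

theorem Core.no_edge_of_even (h : Core G p ℓ U W) {i : Fin k} (hi : Even (p i)) {u x y : V}
    (hu : u ∈ U) (hx : x ∉ U) (hy : y ∉ U) (hux : G.Adj u x) : ¬ G.Adj x y := by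
  intro hxy
  have hF : ({x, y} : Finset V).card ≤ 2 := Finset.card_le_two
  obtain ⟨w, hw, hwF⟩ := h.exists_mem_notMem (F := {x, y}) (by omega)
  have h3 := h.three_le i
  obtain ⟨a, ha⟩ := hi
  exact h.no_special_path (i := i) (by omega) hu (E := {w}) (F := {x, y})
    (by simpa using Finset.disjoint_left.1 h.disj hw) (by simp [hx, hy]) (by simpa using hwF)
    (by rw [Finset.card_singleton]; omega) (fun a ha => hasTail_singleton (h.adj w hw a ha))
    (hasTail_pair hux hxy) (by omega)

theorem Core.no_path_three (h : Core G p ℓ U W) (hH : ¬ ∀ i, p i = 3) {u x y z : V}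
    (hu : u ∈ U) (hx : x ∉ U) (hy : y ∉ U) (hz : z ∉ U) (hux : G.Adj u x) (hxy : G.Adj x y)
    (hyz : G.Adj y z) : z = x := by
  by_contra hne
  have hF : ({x, y, z} : Finset V).card ≤ 3 := Finset.card_le_three
  obtain ⟨w, hw, hwF⟩ := h.exists_mem_notMem hF
  push Not at hH
  obtain ⟨i, hi⟩ := hH
  have h3 := h.three_le i
  exact h.no_special_path (i := i) (by omega) hu (E := {w}) (F := {x, y, z})
    (by simpa using Finset.disjoint_left.1 h.disj hw) (by simp [hx, hy, hz]) (by simpa using hwF)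
    (by rw [Finset.card_singleton]; omega) (fun a ha => hasTail_singleton (h.adj w hw a ha))
    (hasTail_triple hux hxy hyz hne) (by omega)

theorem Core.no_two_edges (h : Core G p ℓ U W) (hH : ¬ ∀ i, p i = 3) {x y z t : V}
    (hx : x ∉ U) (hy : y ∉ U) (hz : z ∉ U) (ht : t ∉ U) (hUx : ∀ u ∈ U, G.Adj u x)
    (hUz : ∀ u ∈ U, G.Adj u z) (hxy : G.Adj x y) (hzt : G.Adj z t)
    (hd : Disjoint ({z, t} : Finset V) {x, y}) : False := by
  push Not at hH
  obtain ⟨i, hi⟩ := hH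
  have h3 := h.three_le i
  have hhalf := h.half_lt i
  have hF : ({x, y} : Finset V).card ≤ 2 := Finset.card_le_two
  have hE : ({z, t} : Finset V).card ≤ 2 := Finset.card_le_two
  obtain ⟨u, hu⟩ := Finset.card_pos.1 (show 0 < U.card by rw [h.card_U]; omega)
  exact h.no_special_path (i := i) (by omega) hu (E := {z, t}) (F := {x, y})
    (by simp [hz, ht]) (by simp [hx, hy]) hd (by omega)
    (fun a ha => hasTail_pair (hUz a ha) hzt) (hasTail_pair (hUx u hu) hxy) (by omega)

theorem Core.exists_degIn_le (h : Core G p ℓ U W) {S : Finset V} (hne : S.Nonempty)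
    (hS : Disjoint S U) : ∃ x ∈ S, degIn G S x ≤ U.card := by
  by_contra! hcon
  obtain ⟨w, hw⟩ := hne
  obtain ⟨l, hl, hlS, -, hlen⟩ := exists_path_of_minDegree (δ := U.card + 1) hcon hw
  have : Nontrivial (Fin k) := Fin.nontrivial_iff_two_le.2 h.two_le
  obtain ⟨i, j, hij⟩ := exists_pair_ne (Fin k)
  have h1 := Finset.add_le_sum (f := fun i => p i / 2) (fun i _ => Nat.zero_le _)
    (Finset.mem_univ i) (Finset.mem_univ j) hij
  rw [← h.sum_eq] at h1
  have hU := h.card_U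
  have h0 : (U.filter fun u => u ∈ l).card = 0 := Finset.card_eq_zero.2
    (Finset.filter_eq_empty_iff.2 fun u hu hul => Finset.disjoint_left.1 hS (hlS u hul) hu)
  have hi := h.three_le i
  have hj := h.three_le j
  rcases le_total (p i / 2) (p j / 2) with hle | hle
  · exact h.no_cheap_path i hl (by omega) (by omega)
  · exact h.no_cheap_path j hl (by omega) (by omega)

theorem Core.nonempty (h : Core G p ℓ U W) : U.Nonempty := by
  have : 0 < k := by have := h.two_le; omega
  have h1 := h.half_lt ⟨0, this⟩
  have h2 := h.three_le ⟨0, this⟩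
  exact Finset.card_pos.1 (by rw [h.card_U]; omega)

theorem degIn_deleteEdges_of_notMem {x y z : V} (S : Finset V) (hx : z ≠ x) (hy : z ≠ y) :
    degIn (G.deleteEdges {s(x, y)}) S z = degIn G S z := by
  unfold degIn
  congr 1
  ext w
  simp only [Finset.mem_filter, SimpleGraph.deleteEdges_adj, Set.mem_singleton_iff, Sym2.eq_iff]
  tauto

variable [Fintype V]

theorem Core.degSum_le_of_no_edge (h : Core G p ℓ U W) (hH : ¬ ∀ i, p i = 3)
    (hno : ∀ x y, x ∉ U → y ∉ U → (∀ u ∈ U, G.Adj u x) → (∀ u ∈ U, G.Adj u y) → ¬ G.Adj x y) :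
    degSum G Finset.univ ≤ degSum G U + 2 * (U.card * (Fintype.card V - U.card)) := by
  have := degSum_union_le h.nonempty
    (fun u hu x y z hx hy hz => h.no_path_three hH hu hx hy hz)
    (fun S hne hS => h.exists_degIn_le hne hS) hno Uᶜ disjoint_compl_left
  rwa [Finset.union_compl, Finset.card_compl] at this

theorem Core.degSum_le_of_edge (h : Core G p ℓ U W) (hH : ¬ ∀ i, p i = 3) {x y : V} (hx : x ∉ U)
    (hy : y ∉ U) (hUx : ∀ u ∈ U, G.Adj u x) (hUy : ∀ u ∈ U, G.Adj u y) (hxy : G.Adj x y) :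
    degSum G Finset.univ ≤ degSum G U + 2 * (U.card * (Fintype.card V - U.card)) + 2 := by
  obtain ⟨u, hu⟩ := h.nonempty
  obtain ⟨G', hG'⟩ : ∃ G', G' = G.deleteEdges {s(x, y)} := ⟨_, rfl⟩
  have hle : G' ≤ G := hG' ▸ SimpleGraph.deleteEdges_le _
  have h1 := degSum_union_le (G := G') h.nonempty
    (fun u hu x y z hx hy hz h1 h2 h3 => h.no_path_three hH hu hx hy hz (hle h1) (hle h2) (hle h3))
    (fun S hne hS => by
      obtain ⟨z, hz, hzd⟩ := h.exists_degIn_le hne hS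
      refine ⟨z, hz, le_trans (Finset.card_le_card fun w hw => ?_) hzd⟩
      rw [Finset.mem_filter] at hw ⊢
      exact ⟨hw.1, hle hw.2⟩)
    (fun z t hz ht hUz hUt hzt => by
      have hzt' := hle hzt
      have key : ∀ a b c, a ∉ U → b ∉ U → c ∉ U → G.Adj u a → G.Adj a b → G.Adj b c → c = a :=
        fun a b c ha hb hc => h.no_path_three hH hu ha hb hc
      have hne : s(z, t) ≠ s(x, y) := by
        intro heq
        rw [hG', SimpleGraph.deleteEdges_adj] at hzt
        exact hzt.2 heq
      refine h.no_two_edges hH hx hy hz ht hUx (fun u hu => hle (hUz u hu)) hxy hzt' ?_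
      simp only [Finset.disjoint_insert_left, Finset.mem_insert, Finset.mem_singleton,
        Finset.disjoint_singleton_left, not_or]
      refine ⟨⟨?_, ?_⟩, ?_, ?_⟩
      · rintro rfl
        exact hne (by rw [key y z t hy hz ht (hUy u hu) hxy.symm hzt'])
      · rintro rfl
        exact hne (by rw [key x z t hx hz ht (hUx u hu) hxy hzt']; exact Sym2.eq_swap)
      · rintro rfl
        exact hne (by rw [key y t z hy ht hz (hUy u hu) hxy.symm hzt'.symm]; exact Sym2.eq_swap)
      · rintro rfl
        exact hne (by rw [key x t z hx ht hz (hUx u hu) hxy hzt'.symm]))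
    Uᶜ disjoint_compl_left
  rw [Finset.union_compl, Finset.card_compl] at h1
  have h2 : degSum G' U = degSum G U := Finset.sum_congr rfl fun z hz => hG' ▸
    degIn_deleteEdges_of_notMem U (by rintro rfl; exact hx hz) (by rintro rfl; exact hy hz)
  have h3 : degSum G Finset.univ = degSum G' Finset.univ + 2 := by
    rw [degSum_univ, degSum_univ]
    have h4 : G.edgeFinset = insert s(x, y) G'.edgeFinset := by
      ext e
      rw [Finset.mem_insert, SimpleGraph.mem_edgeFinset, SimpleGraph.mem_edgeFinset, hG',
        SimpleGraph.edgeSet_deleteEdges, Set.mem_sdiff, Set.mem_singleton_iff]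
      constructor
      · intro he
        by_cases hexy : e = s(x, y)
        exacts [Or.inl hexy, Or.inr ⟨he, hexy⟩]
      · rintro (rfl | he)
        exacts [hxy, he.1]
    rw [h4, Finset.card_insert_of_notMem]
    · ring
    · rw [SimpleGraph.mem_edgeFinset, hG', SimpleGraph.edgeSet_deleteEdges]
      exact fun he => he.2 rfl
  omega

end Structure

section Extremal

variable {n : ℕ} {𝓕 : GraphFamily}

theorem le_ex {W : Type*} (G : SimpleGraph W) [Fintype W] [Fintype G.edgeSet]
    (hG : FamilyFree 𝓕 G) (hn : Fintype.card W = n) : ((G.edgeFinset.card : ℕ) : WithBot ℕ) ≤ ex n 𝓕 := by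
  let e := Fintype.equivFinOfCardEq hn
  let φ := SimpleGraph.Iso.map e G
  have hfree : FamilyFree 𝓕 (G.map e.toEmbedding) := fun X hX h =>
    hG X hX (h.trans ⟨φ.symm.toCopy⟩)
  rw [φ.card_edgeFinset_eq]
  refine le_trans (le_of_eq ?_) (Finset.le_sup
    (f := fun G : SimpleGraph (Fin n) => ((G.edgeFinset.card : ℕ) : WithBot ℕ))
    (Finset.mem_filter.2 ⟨Finset.mem_univ (G.map e.toEmbedding), hfree⟩))
  congr!

theorem ex_le_iff {B : WithBot ℕ} : ex n 𝓕 ≤ B ↔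
    ∀ G : SimpleGraph (Fin n), FamilyFree 𝓕 G → ((G.edgeFinset.card : ℕ) : WithBot ℕ) ≤ B := by
  unfold ex
  rw [Finset.sup_le_iff]
  refine forall_congr' fun G => ?_
  rw [Finset.mem_filter]
  simp

theorem ex_eq_bot_or_exists : ex n 𝓕 = ⊥ ∨ ∃ G : SimpleGraph (Fin n), FamilyFree 𝓕 G ∧
    ex n 𝓕 = ((G.edgeFinset.card : ℕ) : WithBot ℕ) := by
  rcases (Finset.univ.filter fun G : SimpleGraph (Fin n) => FamilyFree 𝓕 G).eq_empty_or_nonempty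
    with h | h
  · left
    unfold ex
    rw [h, Finset.sup_empty]
  · right
    obtain ⟨G, hG, hGe⟩ := Finset.exists_mem_eq_sup _ h
      (fun G : SimpleGraph (Fin n) => ((G.edgeFinset.card : ℕ) : WithBot ℕ))
    exact ⟨G, (Finset.mem_filter.1 hG).2, hGe⟩

theorem familyFree_pair {V₁ V₂ : Type} {F₁ : SimpleGraph V₁} {F₂ : SimpleGraph V₂} {W : Type*}
    {G : SimpleGraph W} : FamilyFree {⟨V₁, F₁⟩, ⟨V₂, F₂⟩} G ↔ F₁.Free G ∧ F₂.Free G := by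
  simp [FamilyFree]

theorem zero_le_ex_G₁ {V : Type} {F : SimpleGraph V} (hχ : 3 ≤ F.chromaticNumber) :
    0 ≤ ex n (G₁ F) := by
  have hfree : FamilyFree (G₁ F) (⊥ : SimpleGraph (Fin n)) := by
    rintro X ⟨S, hS, rfl⟩ ⟨f⟩
    have hS0 : (F.induce S).edgeSet = ∅ := Set.encard_eq_zero.1 hS
    let C : F.Coloring Bool := SimpleGraph.Coloring.mk (fun v => decide (v ∈ S)) (by
      intro v w hvw heq
      rw [decide_eq_decide] at heq
      by_cases hv : v ∈ S
      · have : s((⟨v, hv⟩ : S), ⟨w, heq.1 hv⟩) ∈ (F.induce S).edgeSet := hvw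
        rw [hS0] at this
        exact this
      · exact f.toHom.map_adj (v := ⟨v, hv⟩) (w := ⟨w, fun hw => hv (heq.2 hw)⟩) hvw)
    have h2 := hχ.trans C.colorable.chromaticNumber_le
    norm_num at h2
  exact (WithBot.coe_le_coe.2 (Nat.zero_le _)).trans (le_ex _ hfree (Fintype.card_fin n))

end Extremal

section Join

variable {A B : Type*}

/-- The join of two graphs. -/
def joinGraph (Q : SimpleGraph A) (R : SimpleGraph B) : SimpleGraph (A ⊕ B) :=
  (Q ⊕g R) ⊔ completeBipartiteGraph A B

theorem card_edgeFinset_joinGraph [Fintype A] [Fintype B] (Q : SimpleGraph A)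
    (R : SimpleGraph B) [Fintype Q.edgeSet] [Fintype R.edgeSet] [Fintype (joinGraph Q R).edgeSet] :
    (joinGraph Q R).edgeFinset.card =
      Fintype.card A * Fintype.card B + Q.edgeFinset.card + R.edgeFinset.card := by
  have h := degSum_univ (joinGraph Q R)
  have hQ := degSum_univ Q
  have hR := degSum_univ R
  simp only [degSum, degIn, Finset.card_filter, Fintype.sum_sum_type, Finset.sum_add_distrib]
    at h hQ hR
  have hA : ∀ a a', (joinGraph Q R).Adj (Sum.inl a) (Sum.inl a') ↔ Q.Adj a a' := by
    simp [joinGraph]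
  have hB : ∀ b b', (joinGraph Q R).Adj (Sum.inr b) (Sum.inr b') ↔ R.Adj b b' := by
    simp [joinGraph]
  have hAB : ∀ a b, (joinGraph Q R).Adj (Sum.inl a) (Sum.inr b) := by simp [joinGraph]
  have hBA : ∀ a b, (joinGraph Q R).Adj (Sum.inr b) (Sum.inl a) := by simp [joinGraph]
  simp only [hA, hB, hAB, hBA, if_true, hQ, hR, Finset.sum_const, Finset.card_univ, smul_eq_mul,
    mul_one] at h
  have := mul_comm (Fintype.card B) (Fintype.card A)
  omega

theorem exists_split_of_isContained_joinGraph {V : Type*} {F : SimpleGraph V}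
    {Q : SimpleGraph A} {R : SimpleGraph B} (h : F.IsContained (joinGraph Q R)) :
    ∃ S : Set V, (F.induce S).edgeSet.encard ≤ R.edgeSet.encard ∧
      (F.induce Sᶜ).IsContained Q := by
  obtain ⟨f⟩ := h
  let S : Set V := {v | ∃ b, f v = Sum.inr b}
  have hr : ∀ v : S, ∃ b, f v = Sum.inr b := fun v => v.2
  have hl : ∀ v : (Sᶜ : Set V), ∃ a, f v = Sum.inl a := by
    rintro ⟨v, hv⟩
    rcases hfv : f v with a | b
    · exact ⟨a, rfl⟩
    · exact absurd ⟨b, hfv⟩ hv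
  choose g hg using hr
  choose q hq using hl
  have hadj : ∀ {v w}, F.Adj v w → (joinGraph Q R).Adj (f v) (f w) := fun h => f.toHom.map_adj h
  refine ⟨S, ?_, ⟨⟨⟨q, ?_⟩, ?_⟩⟩⟩
  · let φ : F.induce S →g R := ⟨g, by
      intro v w hvw
      have := hadj (show F.Adj v w from hvw)
      rw [hg, hg] at this
      simpa [joinGraph] using this⟩
    have hφ : Function.Injective φ := by
      intro v w hvw
      have hvw : g v = g w := hvw
      exact Subtype.ext (f.injective ((hg v).trans ((congrArg _ hvw).trans (hg w).symm)))
    exact Function.Embedding.encard_le ⟨_, SimpleGraph.Hom.mapEdgeSet.injective φ hφ⟩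
  · intro v w hvw
    have := hadj (show F.Adj v w from hvw)
    rw [hq, hq] at this
    simpa [joinGraph] using this
  · intro v w hvw
    have hvw : q v = q w := hvw
    exact Subtype.ext (f.injective ((hq v).trans ((congrArg _ hvw).trans (hq w).symm)))

variable {k : ℕ} {p : Fin k → ℕ}

theorem exists_edge_of_isContained_joinGraph [Fintype A] {Q : SimpleGraph A} {R : SimpleGraph B}
    (f : (linearForest p).Copy (joinGraph Q R)) (hA : Fintype.card A < ∑ i, p i / 2) (o : ℕ)
    (ho : ∀ i, 2 * (p i / 2) + o ≤ p i) :
    ∃ (i : Fin k) (a b : Fin (p i)) (x y : B), (∃ j : ℕ, (a : ℕ) = 2 * j + o) ∧ (b : ℕ) = a + 1 ∧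
      f ⟨i, a⟩ = Sum.inr x ∧ f ⟨i, b⟩ = Sum.inr y ∧ R.Adj x y := by
  obtain ⟨i, a, b, hj, hb, haU, hbU⟩ := exists_matching_edge f o ho
    (Finset.univ.image (Sum.inl : A → A ⊕ B))
    (lt_of_le_of_lt Finset.card_image_le (by simpa using hA))
  have hadj : (joinGraph Q R).Adj (f ⟨i, a⟩) (f ⟨i, b⟩) :=
    f.toHom.map_adj (linearForest_adj.2 ⟨i, a, b, Or.inl hb.symm, rfl, rfl⟩)
  rcases hx : f ⟨i, a⟩ with x' | x
  · exact absurd hx (fun hx => haU (by rw [hx]; simp))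
  rcases hy : f ⟨i, b⟩ with y' | y
  · exact absurd hy (fun hy => hbU (by rw [hy]; simp))
  rw [hx, hy] at hadj
  exact ⟨i, a, b, x, y, hj, hb, hx, hy, by simpa [joinGraph] using hadj⟩

theorem linearForest_free_joinGraph_bot [Fintype A] (Q : SimpleGraph A)
    (hA : Fintype.card A < ∑ i, p i / 2) :
    (linearForest p).Free (joinGraph Q (⊥ : SimpleGraph B)) := by
  rintro ⟨f⟩
  obtain ⟨_, _, _, _, _, _, _, _, _, h⟩ := exists_edge_of_isContained_joinGraph f hA 0
    (fun i => Nat.mul_div_le _ _)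
  exact h

theorem linearForest_free_joinGraph_edge [Fintype A] (Q : SimpleGraph A)
    (hA : Fintype.card A < ∑ i, p i / 2) (hodd : ∀ i, Odd (p i)) (x y : B) :
    (linearForest p).Free (joinGraph Q (SimpleGraph.edge x y)) := by
  rintro ⟨f⟩
  obtain ⟨i, a, b, u, v, ⟨j, hj⟩, hb, hau, hbv, huv⟩ :=
    exists_edge_of_isContained_joinGraph f hA 0 (fun i => Nat.mul_div_le _ _)
  obtain ⟨i', a', b', u', v', ⟨j', hj'⟩, hb', hau', hbv', huv'⟩ :=
    exists_edge_of_isContained_joinGraph f hA 1 (fun i => by obtain ⟨m, hm⟩ := hodd i; omega)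
  rw [SimpleGraph.edge_adj] at huv huv'
  have key : (u = u' ∧ v = v') ∨ (u = v' ∧ v = u') := by
    obtain ⟨⟨rfl, rfl⟩ | ⟨rfl, rfl⟩, -⟩ := huv <;>
      obtain ⟨⟨rfl, rfl⟩ | ⟨rfl, rfl⟩, -⟩ := huv' <;> simp
  have hval : ∀ {i i' : Fin k} {a : Fin (p i)} {a' : Fin (p i')},
      f ⟨i, a⟩ = f ⟨i', a'⟩ → (a : ℕ) = a' := by
    intro i i' a a' h
    have := f.injective h
    obtain rfl : i = i' := (Sigma.mk.inj_iff.1 this).1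
    have : a = a' := by simpa using this
    rw [this]
  rcases key with ⟨rfl, rfl⟩ | ⟨rfl, rfl⟩
  · have := hval (hau.trans hau'.symm)
    omega
  · have h1 := hval (hau.trans hbv'.symm)
    have h2 := hval (hbv.trans hau'.symm)
    omega

end Join

section Embedding

variable {V : Type*} {W : Type*} {F : SimpleGraph V} {G : SimpleGraph W} {U : Set W}

theorem isContained_of_split (S : Set V) (f : (F.induce Sᶜ).Copy (G.induce U)) (g : S → W)
    (hg : Function.Injective g) (hgU : ∀ s, g s ∉ U) (hadj : ∀ s, ∀ u ∈ U, G.Adj u (g s))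
    (hS : ∀ a b : S, F.Adj a b → G.Adj (g a) (g b)) : F.IsContained G := by
  refine ⟨⟨⟨fun v => if h : v ∈ S then g ⟨v, h⟩ else f ⟨v, h⟩, ?_⟩, ?_⟩⟩
  · intro v w hvw
    by_cases hv : v ∈ S <;> by_cases hw : w ∈ S <;> simp only [hv, hw, dite_true, dite_false]
    · exact hS ⟨v, hv⟩ ⟨w, hw⟩ hvw
    · exact (hadj _ _ (f ⟨w, hw⟩).2).symm
    · exact hadj _ _ (f ⟨v, hv⟩).2
    · exact f.toHom.map_adj (v := ⟨v, hv⟩) (w := ⟨w, hw⟩) hvw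
  · intro v w hvw
    change (if h : v ∈ S then g ⟨v, h⟩ else f ⟨v, h⟩) =
      (if h : w ∈ S then g ⟨w, h⟩ else f ⟨w, h⟩ : W) at hvw
    by_cases hv : v ∈ S <;> by_cases hw : w ∈ S <;>
      simp only [hv, hw, dite_true, dite_false] at hvw
    · exact congrArg Subtype.val (hg hvw)
    · exact absurd (f ⟨w, hw⟩).2 (hvw ▸ hgU _)
    · exact absurd (f ⟨v, hv⟩).2 (hvw ▸ hgU _)
    · exact congrArg Subtype.val (f.injective (Subtype.ext hvw))

theorem exists_embedding_pair {α β : Type*} (g : α ↪ β) {a b : α} (hab : a ≠ b) {x y : β}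
    (hxy : x ≠ y) : ∃ g' : α ↪ β, g' a = x ∧ g' b = y := by
  let g₁ := g.trans (Equiv.swap (g a) x).toEmbedding
  have h₁ : g₁ a = x := by simp [g₁]
  refine ⟨g₁.trans (Equiv.swap (g₁ b) y).toEmbedding, ?_, by simp⟩
  have h₂ : x ≠ g₁ b := fun h => hab (g₁.injective (h₁.trans h))
  simp [h₁, Equiv.swap_apply_of_ne_of_ne h₂ hxy]

variable [Fintype V] {N : Finset W}

theorem not_isContained_induce_of_free (hF : F.Free G) (hN : Fintype.card V ≤ N.card)
    (hNU : ∀ w ∈ N, w ∉ U) (hadj : ∀ w ∈ N, ∀ u ∈ U, G.Adj u w) (S : Set V)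
    (hS : (F.induce S).edgeSet.encard = 0) : ¬ (F.induce Sᶜ).IsContained (G.induce U) := by
  rintro ⟨f⟩
  obtain ⟨g⟩ : Nonempty (V ↪ N) := Function.Embedding.nonempty_of_card_le (by simpa using hN)
  have hS0 : (F.induce S).edgeSet = ∅ := Set.encard_eq_zero.1 hS
  refine hF (isContained_of_split S f (fun s => g s) ?_ (fun s => hNU _ (g s).2)
    (fun s => hadj _ (g s).2) ?_)
  · exact fun a b hab => Subtype.ext (g.injective (Subtype.ext hab))
  · intro a b hab
    have : s(a, b) ∈ (F.induce S).edgeSet := hab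
    rw [hS0] at this
    exact this.elim

theorem not_isContained_induce_of_free_of_edge (hF : F.Free G) (hN : Fintype.card V ≤ N.card)
    (hNU : ∀ w ∈ N, w ∉ U) (hadj : ∀ w ∈ N, ∀ u ∈ U, G.Adj u w) {x y : W} (hx : x ∈ N)
    (hy : y ∈ N) (hxy : G.Adj x y) (S : Set V)
    (hS : (F.induce S).edgeSet.encard ≤ 1) : ¬ (F.induce Sᶜ).IsContained (G.induce U) := by
  rcases (F.induce S).edgeSet.eq_empty_or_nonempty with h0 | ⟨e, he⟩
  · exact not_isContained_induce_of_free hF hN hNU hadj S (by rw [h0, Set.encard_empty])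
  rintro ⟨f⟩
  induction e using Sym2.ind with
  | _ a b =>
  have hab : F.Adj a b := he
  obtain ⟨g₀⟩ : Nonempty (V ↪ N) := Function.Embedding.nonempty_of_card_le (by simpa using hN)
  obtain ⟨g, hga, hgb⟩ := exists_embedding_pair g₀ hab.ne (x := ⟨x, hx⟩) (y := ⟨y, hy⟩)
    (fun h => hxy.ne (congrArg Subtype.val h))
  refine hF (isContained_of_split S f (fun s => g s) ?_ (fun s => hNU _ (g s).2)
    (fun s => hadj _ (g s).2) ?_)
  · exact fun a b hab => Subtype.ext (g.injective (Subtype.ext hab))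
  · intro c d hcd
    have hcd' : s(c, d) ∈ (F.induce S).edgeSet := hcd
    rcases Sym2.eq_iff.1 (Set.encard_le_one_iff.1 hS _ _ hcd' he) with ⟨rfl, rfl⟩ | ⟨rfl, rfl⟩
    · rw [hga, hgb]; exact hxy
    · rw [hga, hgb]; exact hxy.symm

end Embedding

section Main

variable {k : ℕ} {p : Fin k → ℕ} {ℓ : ℕ} {V : Type} {F : SimpleGraph V}

theorem le_ex_of_G₁ (hℓ : ℓ = ∑ i, p i / 2) (hℓ1 : 1 ≤ ℓ) {n : ℕ} (hn : ℓ ≤ n) :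
    (((ℓ - 1) * (n - ℓ + 1) : ℕ) : WithBot ℕ) + ex (ℓ - 1) (G₁ F) ≤
      ex n {⟨_, linearForest p⟩, ⟨V, F⟩} := by
  rcases ex_eq_bot_or_exists (n := ℓ - 1) (𝓕 := G₁ F) with h | ⟨Q, hQ, h⟩
  · rw [h, WithBot.add_bot]
    exact bot_le
  have hfree : FamilyFree {⟨_, linearForest p⟩, ⟨V, F⟩}
      (joinGraph Q (⊥ : SimpleGraph (Fin (n - ℓ + 1)))) := by
    refine familyFree_pair.2 ⟨linearForest_free_joinGraph_bot Q (by rw [Fintype.card_fin]; omega), ?_⟩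
    intro hc
    obtain ⟨S, hS, hSQ⟩ := exists_split_of_isContained_joinGraph hc
    exact hQ _ ⟨S, by simpa using hS, rfl⟩ hSQ
  have := le_ex _ hfree (n := n) (by simp; omega)
  rw [card_edgeFinset_joinGraph, SimpleGraph.edgeFinset_bot, Finset.card_empty] at this
  rw [h]
  simpa using this

theorem le_ex_of_G₂ (hℓ : ℓ = ∑ i, p i / 2) (hℓ1 : 1 ≤ ℓ) (hodd : ∀ i, Odd (p i)) {n : ℕ}
    (hn : ℓ + 1 ≤ n) :
    (((ℓ - 1) * (n - ℓ + 1) : ℕ) : WithBot ℕ) + (ex (ℓ - 1) (G₂ F) + 1) ≤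
      ex n {⟨_, linearForest p⟩, ⟨V, F⟩} := by
  rcases ex_eq_bot_or_exists (n := ℓ - 1) (𝓕 := G₂ F) with h | ⟨Q, hQ, h⟩
  · rw [h, WithBot.bot_add, WithBot.add_bot]
    exact bot_le
  let x : Fin (n - ℓ + 1) := ⟨0, by omega⟩
  let y : Fin (n - ℓ + 1) := ⟨1, by omega⟩
  have hxy : x ≠ y := fun h => by simp [x, y] at h
  have hedge : (SimpleGraph.edge x y).edgeSet = {s(x, y)} := SimpleGraph.edgeSet_edge_of_ne hxy
  have hfree : FamilyFree {⟨_, linearForest p⟩, ⟨V, F⟩}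
      (joinGraph Q (SimpleGraph.edge x y)) := by
    refine familyFree_pair.2
      ⟨linearForest_free_joinGraph_edge Q (by rw [Fintype.card_fin]; omega) hodd x y, ?_⟩
    intro hc
    obtain ⟨S, hS, hSQ⟩ := exists_split_of_isContained_joinGraph hc
    exact hQ _ ⟨S, by simpa [hedge] using hS, rfl⟩ hSQ
  have := le_ex _ hfree (n := n) (by simp; omega)
  have hcard : ∀ [Fintype (SimpleGraph.edge x y).edgeSet],
      (SimpleGraph.edge x y).edgeFinset.card = 1 := by
    intro _
    rw [Finset.card_eq_one]
    exact ⟨s(x, y), by ext e; rw [SimpleGraph.mem_edgeFinset, hedge]; simp⟩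
  rw [card_edgeFinset_joinGraph, hcard] at this
  rw [h]
  simpa [add_assoc] using this

theorem exists_upper_bound [Fintype V] (hk : 2 ≤ k) (hp : ∀ i, 3 ≤ p i) (hH : ¬ ∀ i, p i = 3)
    (hℓ : ℓ = ∑ i, p i / 2) (hχ : 3 ≤ F.chromaticNumber) :
    ∃ N : ℕ, ∀ n : ℕ, N ≤ n → ∀ G : SimpleGraph (Fin n), (linearForest p).Free G → F.Free G →
      ((G.edgeFinset.card : ℕ) : WithBot ℕ) ≤
          (((ℓ - 1) * (n - ℓ + 1) : ℕ) : WithBot ℕ) + ex (ℓ - 1) (G₁ F) ∨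
        (∀ i, Odd (p i)) ∧ ((G.edgeFinset.card : ℕ) : WithBot ℕ) ≤
          (((ℓ - 1) * (n - ℓ + 1) : ℕ) : WithBot ℕ) + (ex (ℓ - 1) (G₂ F) + 1) := by
  have hℓ1 : 1 ≤ ℓ := by
    have h1 := Finset.single_le_sum (f := fun i => p i / 2) (fun _ _ => Nat.zero_le _)
      (Finset.mem_univ (⟨0, by omega⟩ : Fin k))
    have := hp ⟨0, by omega⟩
    omega
  obtain ⟨M, hM⟩ : ∃ M, M = ∑ i, (p i + 1) + ∑ i, p i + 5 + Fintype.card V := ⟨_, rfl⟩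
  obtain ⟨b, hb⟩ : ∃ b, b = 2 ^ (∑ i, p i) * (M + ∑ i, (p i + 1)) *
      compsBound (2 ^ (∑ i, p i) * (M + ∑ i, (p i + 1))) (∑ i, p i) := ⟨_, rfl⟩
  refine ⟨2 * b ^ 2 + 5 * b + 4 * ℓ ^ 2 + ℓ, fun n hn G hHG hFG => ?_⟩
  by_cases he : (ℓ - 1) * (n - ℓ + 1) ≤ G.edgeFinset.card
  swap
  · left
    refine le_trans ?_ (le_add_of_nonneg_right (zero_le_ex_G₁ hχ))
    exact WithBot.coe_le_coe.2 (not_le.1 he).le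
  obtain ⟨S, hS, hSb⟩ := exists_locallyDense G hℓ1 (b := b)
    (by rw [Fintype.card_fin]; omega) (by rw [Fintype.card_fin]; exact he)
  obtain ⟨U, hU, W, hW, hWU, hadj⟩ := exists_common_neighbors_of_locallyDense hk hp hH hℓ hHG hS
    (M := M) (hb ▸ hSb)
  have hcore : Core G p ℓ U (Finset.univ.filter fun w => w ∉ U ∧ ∀ u ∈ U, G.Adj u w) :=
    ⟨hk, hp, hℓ, hHG, hU, Finset.disjoint_left.2 fun w hw => (Finset.mem_filter.1 hw).2.1,
      fun w hw => (Finset.mem_filter.1 hw).2.2, le_trans (by omega) (hW.trans (Finset.card_le_card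
        fun w hw => Finset.mem_filter.2
          ⟨Finset.mem_univ w, Finset.disjoint_left.1 hWU hw, hadj w hw⟩))⟩
  have hWV : Fintype.card V ≤ W.card := by omega
  have hUc : Fintype.card (Fin n) - U.card = n - ℓ + 1 := by
    rw [Fintype.card_fin, hU]
    omega
  have hUcard : Fintype.card (U : Set (Fin n)) = ℓ - 1 := by simpa using hU
  have hG2 := degSum_univ G
  have hU2 := degSum_induce G U
  by_cases hedge : ∃ x y, x ∉ U ∧ y ∉ U ∧ (∀ u ∈ U, G.Adj u x) ∧ (∀ u ∈ U, G.Adj u y) ∧ G.Adj x y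
  · right
    obtain ⟨x, y, hx, hy, hUx, hUy, hxy⟩ := hedge
    refine ⟨fun i => ?_, ?_⟩
    · rw [← Nat.not_even_iff_odd]
      intro hi
      obtain ⟨u, hu⟩ := hcore.nonempty
      exact hcore.no_edge_of_even hi hu hx hy (hUx u hu) hxy
    · have h1 := hcore.degSum_le_of_edge hH hx hy hUx hUy hxy
      rw [hUc, hU] at h1
      have hfree : FamilyFree (G₂ F) (G.induce (U : Set (Fin n))) := by
        rintro X ⟨T, hT, rfl⟩
        exact not_isContained_induce_of_free_of_edge
          (N := Finset.univ.filter fun w => w ∉ U ∧ ∀ u ∈ U, G.Adj u w) hFG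
          (hWV.trans (Finset.card_le_card fun w hw => Finset.mem_filter.2
            ⟨Finset.mem_univ w, Finset.disjoint_left.1 hWU hw, hadj w hw⟩))
          (fun w hw => (Finset.mem_filter.1 hw).2.1) (fun w hw => (Finset.mem_filter.1 hw).2.2)
          (Finset.mem_filter.2 ⟨Finset.mem_univ x, hx, hUx⟩)
          (Finset.mem_filter.2 ⟨Finset.mem_univ y, hy, hUy⟩) hxy T hT
      have h2 := le_ex _ hfree hUcard
      refine le_trans ?_ (add_le_add_right (add_le_add_left h2 1) _)
      have h3 : G.edgeFinset.card ≤ (ℓ - 1) * (n - ℓ + 1) +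
        ((G.induce (U : Set (Fin n))).edgeFinset.card + 1) := by omega
      exact_mod_cast h3
  · left
    have h1 := hcore.degSum_le_of_no_edge hH
      (fun x y hx hy hUx hUy hxy => hedge ⟨x, y, hx, hy, hUx, hUy, hxy⟩)
    rw [hUc, hU] at h1
    have hfree : FamilyFree (G₁ F) (G.induce (U : Set (Fin n))) := by
      rintro X ⟨T, hT, rfl⟩
      exact not_isContained_induce_of_free hFG hWV (fun w hw => Finset.disjoint_left.1 hWU hw)
        hadj T hT
    have h2 := le_ex _ hfree hUcard
    refine le_trans ?_ (add_le_add_right h2 _)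
    have h3 : G.edgeFinset.card ≤ (ℓ - 1) * (n - ℓ + 1) +
      (G.induce (U : Set (Fin n))).edgeFinset.card := by omega
    exact_mod_cast h3

end Main

end TuranLF

theorem mainTheorem1 {k : ℕ} (hk : 2 ≤ k) (p : Fin k → ℕ) (hp : ∀ i, 3 ≤ p i)
    (hH : ¬ ∀ i, p i = 3) (ℓ : ℕ) (hℓ : ℓ = ∑ i, p i / 2)
    {V : Type} [Fintype V] (F : SimpleGraph V)
    (hχ : 3 ≤ F.chromaticNumber) (hβ : 2 ≤ TuranLF.edgeControlNumber F) :
    ∃ N : ℕ, ∀ n : ℕ, N ≤ n →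
      ((∃ i, Even (p i)) →
        TuranLF.ex n {⟨_, TuranLF.linearForest p⟩, ⟨V, F⟩} =
          (((ℓ - 1) * (n - ℓ + 1) : ℕ) : WithBot ℕ) + TuranLF.ex (ℓ - 1) (TuranLF.G₁ F)) ∧
      ((∀ i, Odd (p i)) →
        TuranLF.ex n {⟨_, TuranLF.linearForest p⟩, ⟨V, F⟩} =
          (((ℓ - 1) * (n - ℓ + 1) : ℕ) : WithBot ℕ) +
            max (TuranLF.ex (ℓ - 1) (TuranLF.G₁ F)) (TuranLF.ex (ℓ - 1) (TuranLF.G₂ F) + 1)) := by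
  have hℓ1 : 1 ≤ ℓ := by
    rw [hℓ]
    exact (show 1 ≤ p ⟨0, by omega⟩ / 2 by have := hp ⟨0, by omega⟩; omega).trans
      (Finset.single_le_sum (f := fun i => p i / 2) (fun _ _ => Nat.zero_le _) (Finset.mem_univ _))
  obtain ⟨N, hN⟩ := TuranLF.exists_upper_bound (F := F) hk hp hH hℓ hχ
  refine ⟨max N (ℓ + 1), fun n hn => ⟨fun ⟨i, hi⟩ => ?_, fun hodd => ?_⟩⟩
  · refine le_antisymm (TuranLF.ex_le_iff.2 fun G hG => ?_)
      (TuranLF.le_ex_of_G₁ hℓ hℓ1 (by omega))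
    obtain ⟨hGH, hGF⟩ := TuranLF.familyFree_pair.1 hG
    rcases hN n (by omega) G hGH hGF with h | ⟨h, -⟩
    · convert h
    · exact absurd hi (Nat.not_even_iff_odd.2 (h i))
  · refine le_antisymm (TuranLF.ex_le_iff.2 fun G hG => ?_) ?_
    · obtain ⟨hGH, hGF⟩ := TuranLF.familyFree_pair.1 hG
      rcases hN n (by omega) G hGH hGF with h | ⟨-, h⟩
      · refine le_trans ?_ (add_le_add_right (le_max_left _ _) _)
        convert h
      · refine le_trans ?_ (add_le_add_right (le_max_right _ _) _)
        convert h
    · rcases max_choice (TuranLF.ex (ℓ - 1) (TuranLF.G₁ F))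
        (TuranLF.ex (ℓ - 1) (TuranLF.G₂ F) + 1) with h | h <;> rw [h]
      · exact TuranLF.le_ex_of_G₁ hℓ hℓ1 (by omega)
      · exact TuranLF.le_ex_of_G₂ hℓ hℓ1 hodd (by omega)
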